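/- Graphs are finite and undirected, and may have parallel edges and self-loops (a self-loop contributes $2$ to the degree of its vertex). For a nonempty proper subset $X$ of the vertices of $G$, the set of edges with exactly one end in $X$ is an \emph{edge cut}, with \emph{sides} $X$ and $V(G)\setminus X$. A graph is \emph{$d$-edge connected} if it has no edge cut with fewer than $d$ edges. Let $k\ge 0$ be an integer. A \emph{transition} at a vertex $v$ without self-loops of a $2k$-regular graph $G$ is a partition $\tau$ of the $2k$ edges at $v$ into $k$ pairs. The graph $G_\tau$ is obtained from $G$ by deleting $v$ and its edges and adding, for each pair $\{vw,vw'\}$ of $\tau$, a new edge $ww'$. The \emph{Martin invariant} $M(G)$ of a $2k$-regular graph $G$ with at least two vertices is defined by the rules: $M(G)=0$ if $G$ has a self-loop; otherwise, $M(G)=1/k!$ if $G$ has two vertices, $M(G)=1$ if $G$ has three vertices, and if $G$ has at least four vertices, then $M(G)=\sum_\tau M(G_\tau)$, where one picks any vertex $v$ and sums over all transitions $\tau$ at $v$. A $2k$-regular graph is \emph{cyclically $(2k+2)$-edge connected} if it is $2k$-edge connected and every edge cut with exactly $2k$ edges has a side that consists of a single vertex. A \emph{decomposition} of a $2k$-regular,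 $2k$-edge connected graph $G$ with at least three vertices is a sequence $G_1,\dots,G_p$ of cyclically $(2k+2)$-edge connected graphs with at least three vertices that is obtained, starting from $G$, by repeatedly choosing an edge cut with exactly $2k$ edges and at least two vertices on each side in one of the graphs, and replacing this graph by the two graphs that arise from it by replacing one side of the cut, respectively the other side, with a single vertex. The graph $G$ is \emph{totally decomposable} if it has a decomposition in which every $G_i$ has exactly three vertices (so that every $G_i$ is a $k$-fold triangle). \textbf{Theorem.} Let $G$ be a $2k$-regular, $2k$-edge connected graph with $n\geq 2$ vertices. Whichever vertices are picked in the computation of $M(G)$, the following hold. \begin{enumerate} \item $M(G)\geq (k!)^{n-3}$. \item If $n=2$, then $M(G)=(k!)^{n-3}=1/k!$. If $n\geq 3$, then $M(G)=(k!)^{n-3}$ if and only if $G$ is totally decomposable. \item If $n\ge 4$ and $G$ is cyclically $(2k+2)$-edge connected, then $M(G)>(k!)^{n-3}$. \end{enumerate} -/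

import Mathlib

open scoped Nat

/-- A finite undirected multigraph, with parallel edges and self-loops allowed: a finite set of
vertices and a multiset of unordered pairs of vertices (the pair `s(v, v)` is a self-loop at `v`). -/
structure Multigraph (V : Type*) where
  verts : Finset V
  edges : Multiset (Sym2 V)
  incl : ∀ e ∈ edges, ∀ a ∈ e, a ∈ verts

namespace Multigraph

variable {V : Type*} [DecidableEq V]

/-- The degree of `v`: the number of edges at `v`, where a self-loop counts twice. -/
def degree (G : Multigraph V) (v : V) : ℕ :=
  G.edges.countP (fun e => v ∈ e) + G.edges.count s(v, v)

def IsRegular (G : Multigraph V) (d : ℕ) : Prop :=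
  ∀ v ∈ G.verts, G.degree v = d

def HasLoop (G : Multigraph V) : Prop :=
  ∃ v ∈ G.verts, s(v, v) ∈ G.edges

instance (G : Multigraph V) : Decidable G.HasLoop :=
  inferInstanceAs (Decidable (∃ v ∈ G.verts, s(v, v) ∈ G.edges))

/-- The number of edges with one end in `X` and the other end outside `X`, that is, the size of the
edge cut that separates `X` from the other vertices. -/
def cutSize (G : Multigraph V) (X : Finset V) : ℕ :=
  G.edges.countP (fun e => (e.toFinset ∩ X).Nonempty ∧ (e.toFinset \ X).Nonempty)

/-- `d`-edge connectedness: there is no edge cut with fewer than `d` edges. -/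
def EdgeConnected (G : Multigraph V) (d : ℕ) : Prop :=
  ∀ X ⊆ G.verts, X.Nonempty → (G.verts \ X).Nonempty → d ≤ G.cutSize X

/-- Cyclic `(2k+2)`-edge connectedness of a `2k`-regular graph: it is `2k`-edge connected, and every
edge cut of size `2k` separates a single vertex from the rest. -/
def CyclicallyConnected (k : ℕ) (G : Multigraph V) : Prop :=
  G.EdgeConnected (2 * k) ∧
    ∀ X ⊆ G.verts, X.Nonempty → (G.verts \ X).Nonempty → G.cutSize X = 2 * k →
      X.card = 1 ∨ (G.verts \ X).card = 1

/-! ### Transitions and the Martin invariant -/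

/-- The edges at a vertex `v` without self-loops: `⟨w, i⟩` is the `i`-th of the parallel edges
between `v` and `w`. -/
abbrev EdgeAt (G : Multigraph V) (v : V) : Type _ :=
  (w : G.verts) × Fin (G.edges.count s(v, (w : V)))

/-- The transitions at `v`: the partitions of the edges at `v` into (unordered) pairs. -/
def transitions (G : Multigraph V) (v : V) : Finset (Finset (Sym2 (G.EdgeAt v))) :=
  Finset.univ.filter fun τ =>
    (∀ p ∈ τ, ¬ p.IsDiag) ∧ ∀ e : G.EdgeAt v, (τ.filter fun p => e ∈ p).card = 1

/-- The graph `G_τ`: remove `v` and its edges, and for each pair `{v w, v w'}` in `τ` add a new edge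
`w w'`. -/
def applyTransition (G : Multigraph V) (hG : ¬ G.HasLoop) (v : V)
    (τ : Finset (Sym2 (G.EdgeAt v))) : Multigraph V where
  verts := G.verts.erase v
  edges := G.edges.filter (fun e => v ∉ e) +
    τ.val.map (Sym2.map fun x : G.EdgeAt v => (x.1 : V))
  incl := by
    intro e he a ha
    rw [Multiset.mem_add] at he
    rcases he with he | he
    · rw [Multiset.mem_filter] at he
      refine Finset.mem_erase.2 ⟨?_, G.incl e he.1 a ha⟩
      rintro rfl
      exact he.2 ha
    · obtain ⟨p, -, rfl⟩ := Multiset.mem_map.1 he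
      obtain ⟨⟨w, i⟩, -, rfl⟩ := Sym2.mem_map.1 ha
      refine Finset.mem_erase.2 ⟨?_, w.2⟩
      intro hw
      have hw' : (w : V) = v := hw
      have hi : 0 < G.edges.count s(v, (w : V)) := i.pos
      rw [hw'] at hi
      exact hG ⟨v, hw' ▸ w.2, Multiset.count_pos.1 hi⟩

/-- A rule that picks a vertex of every graph that has one. -/
abbrev VertexChoice (V : Type*) : Type _ :=
  (G : Multigraph V) → G.verts.Nonempty → {v : V // v ∈ G.verts}

/-- The Martin invariant `M(G)` of a `2k`-regular graph `G` with at least two vertices, computed by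
expanding at the vertices picked by `pick`:
* `M(G) = 0` if `G` has a self-loop;
* `M(G) = 1 / k!` if `G` is the `2k`-fold edge on two vertices;
* `M(G) = 1` if `G` has three vertices and no self-loop;
* otherwise, `M(G)` is the sum of `M(G_τ)` over all transitions `τ` at the picked vertex. -/
def martin (k : ℕ) (pick : VertexChoice V) (G : Multigraph V) : ℚ :=
  if hG : G.HasLoop then 0
  else if G.verts.card ≤ 2 then 1 / (k ! : ℚ)
  else if G.verts.card = 3 then 1
  else if hne : G.verts.Nonempty then
    ∑ τ ∈ G.transitions (pick G hne).1,
      martin k pick (G.applyTransition hG (pick G hne).1 τ)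
  else 0
termination_by G.verts.card
decreasing_by
  exact Finset.card_erase_lt_of_mem (pick G hne).2

/-! ### Decompositions along edge cuts -/

/-- Replace the vertices in `Y` by a single vertex, which is called `y`, and keep the edges that
have an end outside `Y`. -/
def collapse (G : Multigraph V) (Y : Finset V) (y : V) : Multigraph V where
  verts := insert y (G.verts \ Y)
  edges := (G.edges.filter fun e => ¬ e.toFinset ⊆ Y).map
    (Sym2.map fun a => if a ∈ Y then y else a)
  incl := by
    intro e he a ha
    obtain ⟨e', he', rfl⟩ := Multiset.mem_map.1 he
    obtain ⟨b, hb, rfl⟩ := Sym2.mem_map.1 ha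
    have hb' := G.incl e' (Multiset.mem_filter.1 he').1 b hb
    by_cases h : b ∈ Y <;> simp [h, hb']

/-- `IsDecomposition k G L`: the list `L` of cyclically `(2k+2)`-edge connected graphs with at least
three vertices arises from `G` by repeatedly cutting a graph along a `2k`-edge cut, with sides `X`
and `Y`, into the two graphs obtained by replacing one side of the cut with a single vertex. -/
inductive IsDecomposition (k : ℕ) : Multigraph V → List (Multigraph V) → Prop
  | single (G : Multigraph V) (hn : 3 ≤ G.verts.card) (hG : G.CyclicallyConnected k) :
      IsDecomposition k G [G]
  | cut (G : Multigraph V) (X Y : Finset V) (hXY : Disjoint X Y) (hun : X ∪ Y = G.verts)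
      (hX : 2 ≤ X.card) (hY : 2 ≤ Y.card) (hcut : G.cutSize X = 2 * k)
      (x y : V) (hx : x ∈ X) (hy : y ∈ Y) (L₁ L₂ : List (Multigraph V))
      (h₁ : IsDecomposition k (G.collapse Y y) L₁)
      (h₂ : IsDecomposition k (G.collapse X x) L₂) :
      IsDecomposition k G (L₁ ++ L₂)

/-- `G` has a decomposition all of whose members have only three vertices. -/
def TotallyDecomposable (k : ℕ) (G : Multigraph V) : Prop :=
  ∃ L : List (Multigraph V), IsDecomposition k G L ∧ ∀ H ∈ L, H.verts.card = 3

end Multigraph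

set_option linter.unusedSectionVars false

namespace Multigraph

section Pairings

variable {E : Type*} [Fintype E] [DecidableEq E]

/-- The partitions of `S` into unordered pairs. -/
def pairings (S : Finset E) : Finset (Finset (Sym2 E)) :=
  Finset.univ.filter fun τ =>
    (∀ p ∈ τ, ¬ p.IsDiag ∧ ∀ e ∈ p, e ∈ S) ∧ ∀ e ∈ S, (τ.filter fun p => e ∈ p).card = 1

theorem mem_pairings {S : Finset E} {τ : Finset (Sym2 E)} :
    τ ∈ pairings S ↔ (∀ p ∈ τ, ¬ p.IsDiag ∧ ∀ e ∈ p, e ∈ S) ∧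
      ∀ e ∈ S, ∃ p ∈ τ, e ∈ p ∧ ∀ q ∈ τ, e ∈ q → q = p := by
  simp only [pairings, Finset.mem_filter, Finset.mem_univ, true_and]
  refine and_congr_right fun _ => forall₂_congr fun e _ => ?_
  rw [Finset.card_eq_one]
  constructor
  · rintro ⟨p, hp⟩
    have h : ∀ q, q ∈ τ ∧ e ∈ q ↔ q = p := fun q => by
      have := Finset.ext_iff.1 hp q
      rwa [Finset.mem_filter, Finset.mem_singleton] at this
    exact ⟨p, ((h p).2 rfl).1, ((h p).2 rfl).2, fun q hq he => (h q).1 ⟨hq, he⟩⟩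
  · rintro ⟨p, hp, hep, h⟩
    refine ⟨p, Finset.ext fun q => ?_⟩
    rw [Finset.mem_filter, Finset.mem_singleton]
    exact ⟨fun hq => h q hq.1 hq.2, by rintro rfl; exact ⟨hp, hep⟩⟩

theorem pairings_empty : pairings (∅ : Finset E) = {∅} := by
  ext τ
  rw [mem_pairings, Finset.mem_singleton]
  constructor
  · rintro ⟨h, -⟩
    refine Finset.eq_empty_of_forall_notMem fun p hp => ?_
    induction p using Sym2.ind with
    | _ a b => exact absurd ((h _ hp).2 a (Sym2.mem_mk_left a b)) (Finset.notMem_empty _)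
  · rintro rfl
    simp

theorem pair_notMem_of_mem_pairings {S : Finset E} {a b : E} {τ : Finset (Sym2 E)}
    (hτ : τ ∈ pairings ((S.erase a).erase b)) : s(a, b) ∉ τ := fun h => by
  have := ((mem_pairings.1 hτ).1 _ h).2 a (Sym2.mem_mk_left a b)
  simp at this

theorem insert_mem_pairings {S : Finset E} {a b : E} (ha : a ∈ S) (hb : b ∈ S.erase a)
    {τ : Finset (Sym2 E)} (hτ : τ ∈ pairings ((S.erase a).erase b)) :
    insert s(a, b) τ ∈ pairings S := by
  rw [mem_pairings] at hτ ⊢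
  obtain ⟨h1, h2⟩ := hτ
  have hba := Finset.ne_of_mem_erase hb
  have hbS := Finset.mem_of_mem_erase hb
  constructor
  · intro p hp
    rcases Finset.mem_insert.1 hp with rfl | hp
    · refine ⟨by simpa using hba.symm, fun e he => ?_⟩
      rcases Sym2.mem_iff.1 he with rfl | rfl <;> assumption
    · refine ⟨(h1 p hp).1, fun e he => ?_⟩
      exact Finset.mem_of_mem_erase (Finset.mem_of_mem_erase ((h1 p hp).2 e he))
  · intro e he
    by_cases hab : e ∈ s(a, b)
    · refine ⟨s(a, b), Finset.mem_insert_self _ _, hab, fun q hq heq => ?_⟩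
      rcases Finset.mem_insert.1 hq with rfl | hq
      · rfl
      · have := (h1 q hq).2 e heq
        rcases Sym2.mem_iff.1 hab with rfl | rfl <;> simp at this
    · have he' : e ∈ (S.erase a).erase b := by
        rw [Sym2.mem_iff, not_or] at hab
        exact Finset.mem_erase.2 ⟨hab.2, Finset.mem_erase.2 ⟨hab.1, he⟩⟩
      obtain ⟨p, hp, hep, h⟩ := h2 e he'
      refine ⟨p, Finset.mem_insert_of_mem hp, hep, fun q hq heq => ?_⟩
      rcases Finset.mem_insert.1 hq with rfl | hq
      · exact absurd heq hab
      · exact h q hq heq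

theorem exists_eq_insert_of_mem_pairings {S : Finset E} {a : E} (ha : a ∈ S)
    {τ : Finset (Sym2 E)} (hτ : τ ∈ pairings S) :
    ∃ b ∈ S.erase a, ∃ τ' ∈ pairings ((S.erase a).erase b), insert s(a, b) τ' = τ := by
  rw [mem_pairings] at hτ
  obtain ⟨h1, h2⟩ := hτ
  obtain ⟨p, hp, hap, hpu⟩ := h2 a ha
  obtain ⟨b, rfl⟩ := Sym2.mem_iff_exists.1 hap
  have hab : a ≠ b := by simpa using (h1 _ hp).1
  have hbS := (h1 _ hp).2 b (Sym2.mem_mk_right a b)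
  refine ⟨b, Finset.mem_erase.2 ⟨hab.symm, hbS⟩, τ.erase s(a, b), ?_, Finset.insert_erase hp⟩
  rw [mem_pairings]
  obtain ⟨p', hp', hbp', hpu'⟩ := h2 b hbS
  have hu : ∀ q ∈ τ, b ∈ q → q = s(a, b) := fun q hq hbq =>
    (hpu' q hq hbq).trans (hpu' _ hp (Sym2.mem_mk_right a b)).symm
  constructor
  · intro q hq
    have hne := Finset.ne_of_mem_erase hq
    replace hq := Finset.mem_of_mem_erase hq
    refine ⟨(h1 q hq).1, fun e he => ?_⟩
    refine Finset.mem_erase.2 ⟨?_, Finset.mem_erase.2 ⟨?_, (h1 q hq).2 e he⟩⟩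
    · rintro rfl; exact hne (hu q hq he)
    · rintro rfl; exact hne (hpu q hq he)
  · intro e he
    obtain ⟨heb, he⟩ := Finset.mem_erase.1 he
    obtain ⟨hea, he⟩ := Finset.mem_erase.1 he
    obtain ⟨q, hq, heq, h⟩ := h2 e he
    refine ⟨q, Finset.mem_erase.2 ⟨?_, hq⟩, heq, fun r hr her => h r (Finset.mem_of_mem_erase hr) her⟩
    rintro rfl
    rcases Sym2.mem_iff.1 heq with rfl | rfl
    · exact hea rfl
    · exact heb rfl

theorem sum_pairings {M : Type*} [AddCommMonoid M] {S : Finset E} {a : E} (ha : a ∈ S)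
    (Φ : Finset (Sym2 E) → M) :
    ∑ τ ∈ pairings S, Φ τ =
      ∑ b ∈ S.erase a, ∑ τ ∈ pairings ((S.erase a).erase b), Φ (insert s(a, b) τ) := by
  rw [Finset.sum_sigma']
  symm
  refine Finset.sum_bij (fun x _ => insert s(a, x.1) x.2) ?_ ?_ ?_ ?_
  · rintro ⟨b, τ⟩ h
    obtain ⟨hb, hτ⟩ := Finset.mem_sigma.1 h
    exact insert_mem_pairings ha hb hτ
  · rintro ⟨b, τ⟩ h ⟨b', τ'⟩ h' heq
    obtain ⟨hb, hτ⟩ := Finset.mem_sigma.1 h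
    obtain ⟨hb', hτ'⟩ := Finset.mem_sigma.1 h'
    dsimp only at heq hb hτ hb' hτ'
    have hbb : b = b' := by
      have h1 : s(a, b) ∈ insert s(a, b') τ' := heq ▸ Finset.mem_insert_self _ _
      rcases Finset.mem_insert.1 h1 with h1 | h1
      · exact Sym2.congr_right.1 h1
      · have := ((mem_pairings.1 hτ').1 _ h1).2 a (Sym2.mem_mk_left a b)
        simp at this
    subst hbb
    have := congrArg (fun t => t.erase s(a, b)) heq
    rw [Finset.erase_insert (pair_notMem_of_mem_pairings hτ),
      Finset.erase_insert (pair_notMem_of_mem_pairings hτ')] at this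
    rw [this]
  · intro τ hτ
    obtain ⟨b, hb, τ', hτ', rfl⟩ := exists_eq_insert_of_mem_pairings ha hτ
    exact ⟨⟨b, τ'⟩, Finset.mem_sigma.2 ⟨hb, hτ'⟩, rfl⟩
  · intro x _
    rfl

theorem sum_over_pairing {M : Type*} [AddCommMonoid M] (S : Finset E) (g : Sym2 E → M) (h : E → M) :
    ∀ τ ∈ pairings S, (∀ a b, s(a, b) ∈ τ → g s(a, b) = h a + h b) →
    ∑ p ∈ τ, g p = ∑ a ∈ S, h a := by
  induction S using Finset.strongInduction with
  | H S ih =>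
    intro τ hτ hg
    rcases S.eq_empty_or_nonempty with rfl | ⟨a, ha⟩
    · rw [pairings_empty, Finset.mem_singleton] at hτ
      subst hτ
      simp
    · obtain ⟨b, hb, τ', hτ', rfl⟩ := exists_eq_insert_of_mem_pairings ha hτ
      rw [Finset.sum_insert (pair_notMem_of_mem_pairings hτ'), hg a b (Finset.mem_insert_self _ _),
        ih _ ((Finset.erase_subset _ _).trans_ssubset (Finset.erase_ssubset ha)) τ' hτ'
          (fun c d hcd => hg c d (Finset.mem_insert_of_mem hcd)), add_assoc,
        Finset.add_sum_erase _ _ hb, Finset.add_sum_erase _ _ ha]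

theorem card_filter_pairings {S : Finset E} {a : E} (ha : a ∈ S)
    (P : Finset (Sym2 E) → Prop) [DecidablePred P] :
    ((pairings S).filter P).card =
      ∑ b ∈ S.erase a,
        ((pairings ((S.erase a).erase b)).filter fun τ => P (insert s(a, b) τ)).card := by
  simp only [Finset.card_filter]
  exact sum_pairings ha _

theorem image_mem_pairings {E' : Type*} [Fintype E'] [DecidableEq E'] (e : E ≃ E')
    {τ : Finset (Sym2 E)} (hτ : τ ∈ pairings (Finset.univ : Finset E)) :
    τ.image (Sym2.map e) ∈ pairings (Finset.univ : Finset E') := by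
  rw [mem_pairings] at hτ ⊢
  refine ⟨fun p hp => ⟨?_, fun _ _ => Finset.mem_univ _⟩, fun x _ => ?_⟩
  · obtain ⟨q, hq, rfl⟩ := Finset.mem_image.1 hp
    rw [Sym2.isDiag_map e.injective]
    exact (hτ.1 q hq).1
  · have hmem : ∀ q : Sym2 E, x ∈ Sym2.map e q ↔ e.symm x ∈ q := fun q => by
      rw [Sym2.mem_map]
      exact ⟨by rintro ⟨y, hy, rfl⟩; simpa using hy, fun h => ⟨_, h, by simp⟩⟩
    obtain ⟨p, hp, hxp, h⟩ := hτ.2 (e.symm x) (Finset.mem_univ _)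
    refine ⟨Sym2.map e p, Finset.mem_image_of_mem _ hp, (hmem p).2 hxp, fun q hq hxq => ?_⟩
    obtain ⟨q, hq', rfl⟩ := Finset.mem_image.1 hq
    rw [h q hq' ((hmem q).1 hxq)]

theorem image_symm_image {E' : Type*} [Fintype E'] [DecidableEq E'] (e : E ≃ E')
    (τ : Finset (Sym2 E)) : (τ.image (Sym2.map e)).image (Sym2.map e.symm) = τ := by
  rw [Finset.image_image, ← Sym2.map_comp]
  simp

theorem exists_image_eq_of_mem_pairings {E' : Type*} [Fintype E'] [DecidableEq E'] (e : E ≃ E')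
    {τ : Finset (Sym2 E')} (hτ : τ ∈ pairings (Finset.univ : Finset E')) :
    ∃ τ' ∈ pairings (Finset.univ : Finset E), τ'.image (Sym2.map e) = τ :=
  ⟨_, image_mem_pairings e.symm hτ, by simpa using image_symm_image e.symm τ⟩

theorem card_filter_pairings_congr {E' : Type*} [Fintype E'] [DecidableEq E'] (e : E ≃ E')
    (P : Finset (Sym2 E) → Prop) [DecidablePred P] (P' : Finset (Sym2 E') → Prop) [DecidablePred P']
    (h : ∀ τ, P τ ↔ P' (τ.image (Sym2.map e))) :
    ((pairings (Finset.univ : Finset E)).filter P).card =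
      ((pairings (Finset.univ : Finset E')).filter P').card := by
  refine Finset.card_bij (fun τ _ => τ.image (Sym2.map e)) ?_ ?_ ?_
  · intro τ hτ
    rw [Finset.mem_filter] at hτ ⊢
    exact ⟨image_mem_pairings e hτ.1, (h τ).1 hτ.2⟩
  · intro τ _ τ' _ heq
    rw [← image_symm_image e τ, ← image_symm_image e τ', heq]
  · intro τ hτ
    rw [Finset.mem_filter] at hτ
    obtain ⟨τ', hτ', rfl⟩ := exists_image_eq_of_mem_pairings e hτ.1
    exact ⟨τ', Finset.mem_filter.2 ⟨hτ', (h τ').2 hτ.2⟩, rfl⟩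

theorem exists_equiv_of_map_univ_eq {V : Type*} [DecidableEq V] {E' : Type*} [Fintype E']
    (f : E → V) (f' : E' → V)
    (h : (Finset.univ : Finset E).val.map f = (Finset.univ : Finset E').val.map f') :
    ∃ e : E ≃ E', ∀ x, f' (e x) = f x := by
  have hc : ∀ c, Nonempty ({a // f a = c} ≃ {b // f' b = c}) := fun c => by
    refine Fintype.card_eq.1 ?_
    have := congrArg (Multiset.count c) h
    rw [Multiset.count_map, Multiset.count_map] at this
    rw [Fintype.card_subtype, Fintype.card_subtype]
    simpa [Finset.card, Finset.filter, eq_comm] using this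
  exact ⟨Equiv.ofFiberEquiv fun c => (hc c).some, fun x => Equiv.ofFiberEquiv_map _ x⟩

theorem transitions_eq_pairings {V : Type*} [DecidableEq V] (G : Multigraph V) (v : V) :
    G.transitions v = pairings Finset.univ := by
  ext τ
  simp [transitions, pairings]

end Pairings

section Cut

variable {V : Type*} [DecidableEq V]

/-- The number of edges in `D` with exactly one end in `X`. -/
def cut (D : Multiset (Sym2 V)) (X : Finset V) : ℕ :=
  D.countP (fun e => (e.toFinset ∩ X).Nonempty ∧ (e.toFinset \ X).Nonempty)

theorem cutSize_eq_cut (G : Multigraph V) (X : Finset V) : G.cutSize X = cut G.edges X := rfl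

theorem crosses_iff (a b : V) (X : Finset V) :
    ((s(a, b).toFinset ∩ X).Nonempty ∧ (s(a, b).toFinset \ X).Nonempty) ↔ ¬ (a ∈ X ↔ b ∈ X) := by
  have h1 : (s(a, b).toFinset ∩ X).Nonempty ↔ a ∈ X ∨ b ∈ X := by
    simp [Finset.Nonempty, Sym2.mem_toFinset, or_and_right, exists_or]
  have h2 : (s(a, b).toFinset \ X).Nonempty ↔ a ∉ X ∨ b ∉ X := by
    simp [Finset.Nonempty, Sym2.mem_toFinset, or_and_right, exists_or]
  rw [h1, h2]
  tauto

@[simp] theorem cut_zero (X : Finset V) : cut 0 X = 0 := rfl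

theorem cut_add (D D' : Multiset (Sym2 V)) (X : Finset V) : cut (D + D') X = cut D X + cut D' X :=
  Multiset.countP_add _ _ _

@[simp] theorem cut_singleton (a b : V) (X : Finset V) :
    cut {s(a, b)} X = if a ∈ X ↔ b ∈ X then 0 else 1 := by
  rw [cut, ← Multiset.cons_zero, Multiset.countP_cons, Multiset.countP_zero, zero_add]
  simp only [crosses_iff]
  split_ifs <;> simp_all

theorem cut_cons (a b : V) (D : Multiset (Sym2 V)) (X : Finset V) :
    cut (s(a, b) ::ₘ D) X = (if a ∈ X ↔ b ∈ X then 0 else 1) + cut D X := by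
  rw [← Multiset.singleton_add, cut_add, cut_singleton]

/-- A rule to check a statement about cuts edge by edge. -/
theorem edges_induction {p : Multiset (Sym2 V) → Prop} (D : Multiset (Sym2 V)) (h0 : p 0)
    (hs : ∀ a b D, p D → p (s(a, b) ::ₘ D)) : p D := by
  induction D using Multiset.induction_on with
  | empty => exact h0
  | cons e D ih =>
    induction e using Sym2.ind with
    | _ a b => exact hs a b D ih

theorem cut_inter_add_cut_union_le (D : Multiset (Sym2 V)) (X Y : Finset V) :
    cut D (X ∩ Y) + cut D (X ∪ Y) ≤ cut D X + cut D Y := by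
  induction D using edges_induction with
  | h0 => simp
  | hs a b D ih =>
    simp only [cut_cons, Finset.mem_inter, Finset.mem_union]
    by_cases h1 : a ∈ X <;> by_cases h2 : b ∈ X <;> by_cases h3 : a ∈ Y <;> by_cases h4 : b ∈ Y <;>
      simp [h1, h2, h3, h4] <;> omega

theorem cut_sdiff_add_cut_sdiff_le (D : Multiset (Sym2 V)) (X Y : Finset V) :
    cut D (X \ Y) + cut D (Y \ X) ≤ cut D X + cut D Y := by
  induction D using edges_induction with
  | h0 => simp
  | hs a b D ih =>
    simp only [cut_cons, Finset.mem_sdiff]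
    by_cases h1 : a ∈ X <;> by_cases h2 : b ∈ X <;> by_cases h3 : a ∈ Y <;> by_cases h4 : b ∈ Y <;>
      simp [h1, h2, h3, h4] <;> omega

/-- All ends of the edges in `D` are in `W`. -/
def Within (W : Finset V) (D : Multiset (Sym2 V)) : Prop :=
  ∀ a b, s(a, b) ∈ D → a ∈ W ∧ b ∈ W

theorem cut_congr {W X Y : Finset V} {D : Multiset (Sym2 V)} (hD : Within W D)
    (h : ∀ a ∈ W, a ∈ X ↔ a ∈ Y) : cut D X = cut D Y := by
  induction D using edges_induction with
  | h0 => simp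
  | hs a b D ih =>
    have hab := hD a b (Multiset.mem_cons_self _ _)
    rw [cut_cons, cut_cons, ih (fun c d hcd => hD c d (Multiset.mem_cons_of_mem hcd))]
    simp only [h a hab.1, h b hab.2]

theorem cut_compl {W X : Finset V} {D : Multiset (Sym2 V)} (hD : Within W D) :
    cut D (W \ X) = cut D X := by
  induction D using edges_induction with
  | h0 => simp
  | hs a b D ih =>
    have hab := hD a b (Multiset.mem_cons_self _ _)
    rw [cut_cons, cut_cons, ih (fun c d hcd => hD c d (Multiset.mem_cons_of_mem hcd))]
    simp only [Finset.mem_sdiff, hab.1, hab.2, true_and, not_iff_not]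

theorem within_edges (G : Multigraph V) : Within G.verts G.edges := fun a b h =>
  ⟨G.incl _ h a (Sym2.mem_mk_left a b), G.incl _ h b (Sym2.mem_mk_right a b)⟩

end Cut

end Multigraph

namespace Multigraph

section Splitting

variable {V : Type*} [DecidableEq V] {E : Type*} [Fintype E] [DecidableEq E]

/-- The graph with vertices `W` and edges `D` has no edge cut with fewer than `d` edges. -/
def Connected (d : ℕ) (W : Finset V) (D : Multiset (Sym2 V)) : Prop :=
  ∀ Z ⊆ W, Z.Nonempty → (W \ Z).Nonempty → d ≤ cut D Z

/-- The number of half-edges in `S` that end in `Z`. -/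
def endsIn (S : Finset E) (f : E → V) (Z : Finset V) : ℕ :=
  ∑ e ∈ S, if f e ∈ Z then 1 else 0

/-- The size of the cut at `Z` in the graph with edges `D` and, for each `e ∈ S`, an edge from
`f e` to a further vertex. -/
def starCut (D : Multiset (Sym2 V)) (S : Finset E) (f : E → V) (Z : Finset V) : ℕ :=
  cut D Z + endsIn S f Z

/-- All cuts that separate vertices other than the centre of the star have at least `d` edges. -/
def StarConnected (d : ℕ) (W : Finset V) (D : Multiset (Sym2 V)) (S : Finset E) (f : E → V) :
    Prop :=
  ∀ Z ⊆ W, Z.Nonempty → (W \ Z).Nonempty → d ≤ starCut D S f Z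

theorem endsIn_erase_erase {S : Finset E} (f : E → V) {a b : E} (ha : a ∈ S) (hb : b ∈ S.erase a)
    (Z : Finset V) :
    (if f a ∈ Z then 1 else 0) + ((if f b ∈ Z then 1 else 0) + endsIn ((S.erase a).erase b) f Z) =
      endsIn S f Z := by
  rw [endsIn, Finset.add_sum_erase _ (fun e => if f e ∈ Z then 1 else 0) hb,
    Finset.add_sum_erase _ (fun e => if f e ∈ Z then 1 else 0) ha, endsIn]

theorem starCut_split (D : Multiset (Sym2 V)) {S : Finset E} (f : E → V) {a b : E} (ha : a ∈ S)
    (hb : b ∈ S.erase a) (Z : Finset V) :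
    starCut (s(f a, f b) ::ₘ D) ((S.erase a).erase b) f Z +
      (if f a ∈ Z ∧ f b ∈ Z then 2 else 0) = starCut D S f Z := by
  rw [starCut, starCut, ← endsIn_erase_erase f ha hb, cut_cons]
  by_cases h1 : f a ∈ Z <;> by_cases h2 : f b ∈ Z <;> simp [h1, h2] <;> omega

theorem endsIn_inter_add_union (S : Finset E) (f : E → V) (X Y : Finset V) :
    endsIn S f (X ∩ Y) + endsIn S f (X ∪ Y) = endsIn S f X + endsIn S f Y := by
  simp only [endsIn, ← Finset.sum_add_distrib]
  refine Finset.sum_congr rfl fun e _ => ?_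
  by_cases h1 : f e ∈ X <;> by_cases h2 : f e ∈ Y <;> simp [h1, h2]

theorem endsIn_sdiff (S : Finset E) (f : E → V) (X Y : Finset V) :
    endsIn S f (X \ Y) + endsIn S f (Y \ X) + 2 * endsIn S f (X ∩ Y) =
      endsIn S f X + endsIn S f Y := by
  simp only [endsIn, ← Finset.sum_add_distrib, Finset.mul_sum]
  refine Finset.sum_congr rfl fun e _ => ?_
  by_cases h1 : f e ∈ X <;> by_cases h2 : f e ∈ Y <;> simp [h1, h2]

theorem endsIn_compl {W : Finset V} {S : Finset E} {f : E → V} (hf : ∀ e ∈ S, f e ∈ W)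
    (Z : Finset V) : endsIn S f (W \ Z) + endsIn S f Z = S.card := by
  simp only [endsIn, ← Finset.sum_add_distrib]
  rw [Finset.card_eq_sum_ones]
  refine Finset.sum_congr rfl fun e he => ?_
  by_cases h1 : f e ∈ Z <;> simp [h1, hf e he]

theorem endsIn_pos {S : Finset E} {f : E → V} {Z : Finset V} {a : E} (ha : a ∈ S) (h : f a ∈ Z) :
    0 < endsIn S f Z :=
  Finset.sum_pos' (fun _ _ => Nat.zero_le _) ⟨a, ha, by simp [h]⟩

/-- Of the half-edges in `S` other than `a`, at least half can be paired with `a` without creating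
a small cut. -/
theorem exists_admissible {k j : ℕ} {W : Finset V} {D : Multiset (Sym2 V)} {S : Finset E}
    {f : E → V} (hD : Within W D) (hf : ∀ e ∈ S, f e ∈ W) (hc : StarConnected (2 * k) W D S f)
    (heven : ∀ Z ⊆ W, Even (starCut D S f Z)) (hj : S.card = 2 * j) {a : E} (ha : a ∈ S) :
    ∃ A ⊆ S.erase a, j ≤ A.card ∧
      ∀ b ∈ A, StarConnected (2 * k) W (s(f a, f b) ::ₘ D) ((S.erase a).erase b) f := by
  classical
  let tight : Finset (Finset V) := W.powerset.filter fun Z =>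
    f a ∈ Z ∧ (W \ Z).Nonempty ∧ starCut D S f Z = 2 * k
  have hmem : ∀ Z, Z ∈ tight ↔ Z ⊆ W ∧ f a ∈ Z ∧ (W \ Z).Nonempty ∧ starCut D S f Z = 2 * k :=
    fun Z => by simp [tight]
  have hadm : ∀ b ∈ S.erase a, (∀ Z ∈ tight, f b ∉ Z) →
      StarConnected (2 * k) W (s(f a, f b) ::ₘ D) ((S.erase a).erase b) f := by
    intro b hb hbt Z hZ hne hne'
    have h1 := starCut_split D f ha hb Z
    have h2 := hc Z hZ hne hne'
    split_ifs at h1 with hab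
    · have h3 : starCut D S f Z ≠ 2 * k := fun h => hbt Z ((hmem Z).2 ⟨hZ, hab.1, hne', h⟩) hab.2
      obtain ⟨r, hr⟩ := heven Z hZ
      omega
    · omega
  have hcard : (S.erase a).card + 1 = 2 * j := by rw [← hj, Finset.card_erase_add_one ha]
  rcases tight.eq_empty_or_nonempty with h0 | hne
  · refine ⟨S.erase a, subset_rfl, by omega, fun b hb => hadm b hb fun Z hZ => ?_⟩
    simp [h0] at hZ
  obtain ⟨T, hT, hmax⟩ := Finset.exists_max_image tight Finset.card hne
  obtain ⟨hTW, haT, hTne, hTc⟩ := (hmem T).1 hT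
  have hunion : ∀ Z ∈ tight, Z ⊆ T := by
    intro Z hZ
    obtain ⟨hZW, haZ, hZne, hZc⟩ := (hmem Z).1 hZ
    have hU : Z ∪ T ⊆ W := Finset.union_subset hZW hTW
    have hI : Z ∩ T ⊆ W := Finset.inter_subset_left.trans hZW
    have hIne : f a ∈ Z ∩ T := Finset.mem_inter.2 ⟨haZ, haT⟩
    by_cases hUW : (W \ (Z ∪ T)).Nonempty
    · have h1 := hc (Z ∪ T) hU ⟨f a, Finset.mem_union_left _ haZ⟩ hUW
      have h2 := hc (Z ∩ T) hI ⟨_, hIne⟩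
        (hZne.mono (Finset.sdiff_subset_sdiff subset_rfl Finset.inter_subset_left))
      have h3 := cut_inter_add_cut_union_le D Z T
      have h4 := endsIn_inter_add_union S f Z T
      have h5 : Z ∪ T ∈ tight := by
        refine (hmem _).2 ⟨hU, Finset.mem_union_left _ haZ, hUW, ?_⟩
        simp only [starCut] at *
        omega
      have h6 := Finset.eq_of_subset_of_card_le Finset.subset_union_right (hmax _ h5)
      rw [h6]
      exact Finset.subset_union_left
    · exfalso
      have hcov : ∀ x ∈ W, x ∈ Z ∨ x ∈ T := fun x hx => by
        by_contra hcon
        exact hUW ⟨x, Finset.mem_sdiff.2 ⟨hx, by rwa [Finset.mem_union]⟩⟩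
      obtain ⟨z, hz⟩ := hZne
      obtain ⟨t, ht⟩ := hTne
      rw [Finset.mem_sdiff] at hz ht
      have h1 := hc (Z \ T) (Finset.sdiff_subset.trans hZW)
        ⟨t, Finset.mem_sdiff.2 ⟨(hcov t ht.1).resolve_right ht.2, ht.2⟩⟩
        ⟨f a, by simp [hf a ha, haT]⟩
      have h2 := hc (T \ Z) (Finset.sdiff_subset.trans hTW)
        ⟨z, Finset.mem_sdiff.2 ⟨(hcov z hz.1).resolve_left hz.2, hz.2⟩⟩
        ⟨f a, by simp [hf a ha, haZ]⟩
      have h3 := cut_sdiff_add_cut_sdiff_le D Z T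
      have h4 := endsIn_sdiff S f Z T
      have h5 := endsIn_pos ha hIne
      simp only [starCut] at *
      omega
  refine ⟨(S.erase a).filter fun b => f b ∉ T, Finset.filter_subset _ _, ?_, fun b hb => ?_⟩
  · have h1 := hc (W \ T) Finset.sdiff_subset hTne
      ⟨f a, by simp [hf a ha, haT]⟩
    have h2 := endsIn_compl hf T
    have h3 : cut D (W \ T) = cut D T := cut_compl hD
    have h4 : endsIn S f T = 1 + ((S.erase a).filter fun b => f b ∈ T).card := by
      rw [endsIn, ← Finset.add_sum_erase _ _ ha, Finset.card_filter, if_pos haT]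
    have h5 := Finset.card_filter_add_card_filter_not (s := S.erase a) (fun b => f b ∈ T)
    simp only [starCut] at *
    omega
  · rw [Finset.mem_filter] at hb
    exact hadm b hb.1 fun Z hZ h => hb.2 (hunion Z hZ h)

theorem mul_le_card_filter_pairings {S : Finset E} {a : E} (ha : a ∈ S)
    (P : Finset (Sym2 E) → Prop) [DecidablePred P] {A : Finset E} (hA : A ⊆ S.erase a) {m : ℕ}
    (h : ∀ b ∈ A, m ≤
      ((pairings ((S.erase a).erase b)).filter fun τ => P (insert s(a, b) τ)).card) :
    A.card * m ≤ ((pairings S).filter P).card := by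
  rw [card_filter_pairings ha]
  calc A.card * m = ∑ _b ∈ A, m := by simp
    _ ≤ _ := Finset.sum_le_sum h
    _ ≤ _ := Finset.sum_le_sum_of_subset hA

theorem map_insert_pair {a b : E} {τ : Finset (Sym2 E)} (h : s(a, b) ∉ τ) (f : E → V) :
    (insert s(a, b) τ).val.map (Sym2.map f) = s(f a, f b) ::ₘ τ.val.map (Sym2.map f) := by
  rw [Finset.insert_val_of_notMem h, Multiset.map_cons, Sym2.map_mk]

theorem even_starCut_split {W : Finset V} {D : Multiset (Sym2 V)} {S : Finset E} {f : E → V}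
    (heven : ∀ Z ⊆ W, Even (starCut D S f Z)) {a b : E} (ha : a ∈ S) (hb : b ∈ S.erase a) :
    ∀ Z ⊆ W, Even (starCut (s(f a, f b) ::ₘ D) ((S.erase a).erase b) f Z) := by
  intro Z hZ
  obtain ⟨r, hr⟩ := heven Z hZ
  have h1 := starCut_split D f ha hb Z
  split_ifs at h1
  · exact ⟨r - 1, by omega⟩
  · exact ⟨r, by omega⟩

theorem within_cons {W : Finset V} {D : Multiset (Sym2 V)} (hD : Within W D) {a b : V}
    (ha : a ∈ W) (hb : b ∈ W) : Within W (s(a, b) ::ₘ D) := by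
  intro c d h
  rcases Multiset.mem_cons.1 h with h | h
  · rcases Sym2.eq_iff.1 h with ⟨rfl, rfl⟩ | ⟨rfl, rfl⟩
    · exact ⟨ha, hb⟩
    · exact ⟨hb, ha⟩
  · exact hD c d h

/-- There are at least `j!` ways to pair `2 * j` half-edges without creating a small cut. -/
theorem factorial_le_card_filter_pairings {k : ℕ} {W : Finset V} {f : E → V} (j : ℕ) :
    ∀ (D : Multiset (Sym2 V)) (S : Finset E), Within W D → (∀ e ∈ S, f e ∈ W) →
      StarConnected (2 * k) W D S f → (∀ Z ⊆ W, Even (starCut D S f Z)) → S.card = 2 * j →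
      ∀ (P : Finset (Sym2 E) → Prop) [DecidablePred P],
        (∀ τ ∈ pairings S, Connected (2 * k) W (D + τ.val.map (Sym2.map f)) → P τ) →
        j ! ≤ ((pairings S).filter P).card := by
  induction j with
  | zero =>
    intro D S hD hf hc heven hj P _ hP
    obtain rfl : S = ∅ := by simpa using hj
    have h : P ∅ := hP ∅ (by simp [pairings_empty]) (by
      simpa [Connected, StarConnected, starCut, endsIn] using hc)
    rw [pairings_empty, Finset.filter_singleton, if_pos h]
    simp
  | succ j ih =>
    intro D S hD hf hc heven hj P _ hP
    obtain ⟨a, ha⟩ : S.Nonempty := Finset.card_pos.1 (by omega)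
    obtain ⟨A, hA, hAc, hAs⟩ := exists_admissible hD hf hc heven hj ha
    rw [Nat.factorial_succ]
    refine (Nat.mul_le_mul_right _ hAc).trans (mul_le_card_filter_pairings ha P hA fun b hb => ?_)
    have hbS := hA hb
    refine ih _ _ (within_cons hD (hf a ha) (hf b (Finset.mem_of_mem_erase hbS)))
      (fun e he => hf e (Finset.mem_of_mem_erase (Finset.mem_of_mem_erase he))) (hAs b hb)
      (even_starCut_split heven ha hbS) ?_ _ fun τ hτ hcon => ?_
    · have h1 := Finset.card_erase_add_one hbS
      have h2 := Finset.card_erase_add_one ha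
      omega
    · refine hP _ (insert_mem_pairings ha hbS hτ) ?_
      rw [map_insert_pair (pair_notMem_of_mem_pairings hτ), Multiset.add_cons, ← Multiset.cons_add]
      exact hcon

/-- There are at most `j!` ways to pair `j` elements of one kind with `j` of the other. -/
theorem card_filter_pairings_le_factorial (c : E → Prop) [DecidablePred c] (j : ℕ) :
    ∀ (S : Finset E), (S.filter c).card = j → (S.filter fun e => ¬ c e).card = j →
      ∀ (P : Finset (Sym2 E) → Prop) [DecidablePred P],
        (∀ τ ∈ pairings S, P τ → ∀ a b, s(a, b) ∈ τ → c a → ¬ c b) →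
        ((pairings S).filter P).card ≤ j ! := by
  induction j with
  | zero =>
    intro S h1 h2 P _ _
    have h := Finset.card_filter_add_card_filter_not (s := S) c
    obtain rfl : S = ∅ := Finset.card_eq_zero.1 (by omega)
    rw [pairings_empty]
    exact (Finset.card_filter_le _ _).trans (by simp)
  | succ j ih =>
    intro S h1 h2 P _ hP
    obtain ⟨a, ha⟩ : (S.filter c).Nonempty := Finset.card_pos.1 (by omega)
    obtain ⟨haS, hca⟩ := Finset.mem_filter.1 ha
    rw [card_filter_pairings haS, Nat.factorial_succ]
    have hsub : (S.filter fun e => ¬ c e) ⊆ S.erase a := fun b hb => by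
      rw [Finset.mem_filter] at hb
      exact Finset.mem_erase.2 ⟨by rintro rfl; exact hb.2 hca, hb.1⟩
    rw [← Finset.sum_subset hsub, ← h2, ← smul_eq_mul]
    · refine Finset.sum_le_card_nsmul _ _ _ fun b hb => ?_
      have hbS := hsub hb
      have hcb := (Finset.mem_filter.1 hb).2
      refine ih _ ?_ ?_ _ fun τ hτ h c d hcd =>
        hP _ (insert_mem_pairings haS hbS hτ) h c d (Finset.mem_insert_of_mem hcd)
      · rw [Finset.erase_right_comm, Finset.filter_erase, Finset.card_erase_of_mem, Finset.filter_erase,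
          Finset.erase_eq_of_notMem, h1, Nat.add_sub_cancel]
        · simp [hcb]
        · simp [Finset.filter_erase, haS, hca]
          rintro rfl; exact hcb hca
      · rw [Finset.filter_erase, Finset.card_erase_of_mem, Finset.filter_erase,
          Finset.erase_eq_of_notMem, h2, Nat.add_sub_cancel]
        · simp [hca]
        · simpa [Finset.filter_erase] using ⟨by rintro rfl; exact hcb hca, (Finset.mem_filter.1 hb).1, hcb⟩
    · intro b hb hbn
      rw [Finset.card_eq_zero, Finset.filter_eq_empty_iff]
      intro τ hτ h
      refine hbn (Finset.mem_filter.2 ⟨Finset.mem_of_mem_erase hb, ?_⟩)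
      exact hP _ (insert_mem_pairings haS hb hτ) h a b (Finset.mem_insert_self _ _) hca

end Splitting

end Multigraph

namespace Multigraph

section Star

variable {V : Type*} [DecidableEq V] {E : Type*} [Fintype E] [DecidableEq E]

/-- The degree of `u` in a graph with edges `D`. -/
def deg (D : Multiset (Sym2 V)) (u : V) : ℕ :=
  D.countP (fun e => u ∈ e) + D.count s(u, u)

theorem degree_eq_deg (G : Multigraph V) (u : V) : G.degree u = deg G.edges u := rfl

@[simp] theorem deg_zero (u : V) : deg 0 u = 0 := rfl

theorem deg_add (D D' : Multiset (Sym2 V)) (u : V) : deg (D + D') u = deg D u + deg D' u := by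
  rw [deg, deg, deg, Multiset.countP_add, Multiset.count_add]
  omega

@[simp] theorem deg_singleton (a b u : V) :
    deg {s(a, b)} u = (if a = u then 1 else 0) + (if b = u then 1 else 0) := by
  rw [deg, ← Multiset.cons_zero, Multiset.countP_cons, Multiset.count_cons]
  by_cases h1 : a = u <;> by_cases h2 : b = u <;> simp [h1, h2, eq_comm]

theorem deg_cons (a b : V) (D : Multiset (Sym2 V)) (u : V) :
    deg (s(a, b) ::ₘ D) u = (if a = u then 1 else 0) + (if b = u then 1 else 0) + deg D u := by
  rw [← Multiset.singleton_add, deg_add, deg_singleton]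

theorem deg_eq_cut_add (D : Multiset (Sym2 V)) (u : V) :
    deg D u = cut D {u} + 2 * D.count s(u, u) := by
  induction D using edges_induction with
  | h0 => simp
  | hs a b D ih =>
    rw [deg_cons, cut_cons, Multiset.count_cons, ih]
    by_cases h1 : a = u <;> by_cases h2 : b = u <;> simp [h1, h2, eq_comm]
    · ring
    · subst h1; rw [if_neg (by simpa [eq_comm] using h2)]; ring
    · subst h2; rw [if_neg (by simpa [eq_comm] using h1)]; ring
    · exact ⟨fun h => absurd h.symm h1, fun h => absurd h.symm h2⟩

theorem even_sum_deg_add_cut (D : Multiset (Sym2 V)) (Z : Finset V) :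
    Even (∑ z ∈ Z, deg D z + cut D Z) := by
  induction D using edges_induction with
  | h0 => simp
  | hs a b D ih =>
    simp only [deg_cons, cut_cons, Finset.sum_add_distrib, Finset.sum_ite_eq]
    obtain ⟨r, hr⟩ := ih
    by_cases h1 : a ∈ Z <;> by_cases h2 : b ∈ Z <;> simp only [h1, h2, if_true, if_false, iff_true, iff_false,
      not_true, iff_self]
    · exact ⟨r + 1, by omega⟩
    · exact ⟨r + 1, by omega⟩
    · exact ⟨r + 1, by omega⟩
    · exact ⟨r, by omega⟩

theorem even_cut {k : ℕ} {W : Finset V} {D : Multiset (Sym2 V)} (h : ∀ u ∈ W, deg D u = 2 * k)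
    {Z : Finset V} (hZ : Z ⊆ W) : Even (cut D Z) := by
  have h1 := even_sum_deg_add_cut D Z
  rw [Finset.sum_congr rfl fun z hz => h z (hZ hz), Finset.sum_const, smul_eq_mul] at h1
  exact (Nat.even_add.1 h1).1 (((even_two_mul k)).mul_left _)

theorem cut_map_val {ι : Type*} (S : Finset ι) (g : ι → Sym2 V) (Z : Finset V) :
    cut (S.val.map g) Z = ∑ x ∈ S, cut {g x} Z := by
  classical
  induction S using Finset.induction_on with
  | empty => simp
  | insert a S ha ih =>
    rw [Finset.sum_insert ha, Finset.insert_val_of_notMem ha, Multiset.map_cons,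
      ← Multiset.singleton_add, cut_add, ih]

theorem deg_map_val {ι : Type*} (S : Finset ι) (g : ι → Sym2 V) (u : V) :
    deg (S.val.map g) u = ∑ x ∈ S, deg {g x} u := by
  classical
  induction S using Finset.induction_on with
  | empty => simp
  | insert a S ha ih =>
    rw [Finset.sum_insert ha, Finset.insert_val_of_notMem ha, Multiset.map_cons,
      ← Multiset.singleton_add, deg_add, ih]

theorem cut_empty (D : Multiset (Sym2 V)) : cut D ∅ = 0 := by
  induction D using edges_induction with
  | h0 => simp
  | hs a b D ih => simp [cut_cons, ih]

/-- The edges of `G` are `D`, which avoids `v`, and one edge from `v` to `f e` for each `e`. -/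
structure StarAt (G : Multigraph V) (v : V) (D : Multiset (Sym2 V)) (f : E → V) : Prop where
  mem : v ∈ G.verts
  edges_eq : G.edges = D + (Finset.univ : Finset E).val.map (fun e => s(v, f e))
  within : Within (G.verts.erase v) D
  ends_mem : ∀ e, f e ∈ G.verts.erase v

theorem StarAt.cut_eq {G : Multigraph V} {v : V} {D : Multiset (Sym2 V)} {f : E → V}
    (h : StarAt G v D f) {Z : Finset V} (hZ : v ∉ Z) :
    cut G.edges Z = starCut D Finset.univ f Z := by
  rw [h.edges_eq, cut_add, starCut, cut_map_val, endsIn]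
  congr 1
  refine Finset.sum_congr rfl fun e _ => ?_
  simp [hZ]

theorem StarAt.cut_center {G : Multigraph V} {v : V} {D : Multiset (Sym2 V)} {f : E → V}
    (h : StarAt G v D f) : cut G.edges {v} = Fintype.card E := by
  have h1 : cut D {v} = 0 := by
    rw [cut_congr (Y := ∅) h.within fun a ha => by simp [Finset.ne_of_mem_erase ha], cut_empty]
  rw [h.edges_eq, cut_add, h1, cut_map_val, zero_add, ← Finset.card_univ, Finset.card_eq_sum_ones]
  refine Finset.sum_congr rfl fun e _ => ?_
  simp [Finset.ne_of_mem_erase (h.ends_mem e)]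

theorem cut_pairing {S : Finset E} (f : E → V) {τ : Finset (Sym2 E)} (hτ : τ ∈ pairings S)
    (Z : Finset V) :
    cut (τ.val.map (Sym2.map f)) Z +
      2 * (τ.filter fun p => (Sym2.map f p).toFinset ⊆ Z).card = endsIn S f Z := by
  rw [cut_map_val, Finset.card_filter, Finset.mul_sum, ← Finset.sum_add_distrib]
  refine sum_over_pairing S _ _ τ hτ fun a b _ => ?_
  have h : (Sym2.map f s(a, b)).toFinset ⊆ Z ↔ f a ∈ Z ∧ f b ∈ Z := by
    simp [Finset.subset_iff, Sym2.mem_toFinset]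
  rw [Sym2.map_mk] at *
  simp only [h, cut_singleton]
  by_cases h1 : f a ∈ Z <;> by_cases h2 : f b ∈ Z <;> simp [h1, h2]

theorem deg_pairing {S : Finset E} (f : E → V) {τ : Finset (Sym2 E)} (hτ : τ ∈ pairings S)
    (u : V) : deg (τ.val.map (Sym2.map f)) u = ∑ e ∈ S, if f e = u then 1 else 0 := by
  rw [deg_map_val]
  refine sum_over_pairing S _ _ τ hτ fun a b _ => ?_
  rw [Sym2.map_mk, deg_singleton]

theorem StarAt.cut_pairing_add {G : Multigraph V} {v : V} {D : Multiset (Sym2 V)} {f : E → V}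
    (h : StarAt G v D f) {τ : Finset (Sym2 E)} (hτ : τ ∈ pairings Finset.univ)
    {Z : Finset V} (hZ : v ∉ Z) :
    cut (D + τ.val.map (Sym2.map f)) Z +
      2 * (τ.filter fun p => (Sym2.map f p).toFinset ⊆ Z).card = cut G.edges Z := by
  rw [h.cut_eq hZ, starCut, cut_add, add_assoc, cut_pairing f hτ]

theorem StarAt.deg_pairing {G : Multigraph V} {v : V} {D : Multiset (Sym2 V)} {f : E → V}
    (h : StarAt G v D f) {τ : Finset (Sym2 E)} (hτ : τ ∈ pairings Finset.univ)
    {u : V} (hu : u ≠ v) : deg (D + τ.val.map (Sym2.map f)) u = deg G.edges u := by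
  rw [h.edges_eq, deg_add, deg_add, Multigraph.deg_pairing f hτ, deg_map_val]
  congr 1
  refine Finset.sum_congr rfl fun e _ => ?_
  simp [hu.symm]

theorem not_hasLoop_of_connected {k : ℕ} {G : Multigraph V} (hreg : G.IsRegular (2 * k))
    (hconn : G.EdgeConnected (2 * k)) (hn : 2 ≤ G.verts.card) : ¬ G.HasLoop := by
  rintro ⟨u, hu, hl⟩
  have h1 := hreg u hu
  rw [degree_eq_deg, deg_eq_cut_add] at h1
  have h2 : 2 * k ≤ cut G.edges {u} := hconn {u} (by simpa using hu) ⟨u, by simp⟩ (by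
    rw [Finset.sdiff_singleton_eq_erase, ← Finset.card_pos, Finset.card_erase_of_mem hu]
    omega)
  have h3 := Multiset.count_pos.2 hl
  omega

theorem starAt_of_not_hasLoop {G : Multigraph V} (hG : ¬ G.HasLoop) {v : V} (hv : v ∈ G.verts) :
    StarAt G v (G.edges.filter fun e => v ∉ e) (fun x : G.EdgeAt v => (x.1 : V)) where
  mem := hv
  edges_eq := by
    ext e
    rw [Multiset.count_add, Multiset.count_map]
    by_cases hve : v ∈ e
    · rw [Multiset.count_filter_of_neg (by simpa using hve), zero_add]
      obtain ⟨w, rfl⟩ := Sym2.mem_iff_exists.1 hve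
      have h1 : ∀ x : G.EdgeAt v, s(v, w) = s(v, (x.1 : V)) ↔ (x.1 : V) = w := fun x => by
        rw [Sym2.congr_right, eq_comm]
      simp only [h1]
      by_cases hw : w ∈ G.verts
      · change _ = (Finset.univ.filter fun x : G.EdgeAt v => (x.1 : V) = w).card
        have : (Finset.univ.filter fun x : G.EdgeAt v => (x.1 : V) = w) =
            (Finset.univ : Finset (Fin (G.edges.count s(v, w)))).map
              ⟨fun i => (⟨⟨w, hw⟩, i⟩ : G.EdgeAt v), fun i j h => by simpa using h⟩ := by
          ext ⟨⟨u, hu⟩, i⟩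
          simp only [Finset.mem_filter, Finset.mem_univ, true_and, Finset.mem_map]
          constructor
          · rintro rfl
            exact ⟨i, rfl⟩
          · rintro ⟨j, hj⟩
            exact (congrArg (fun x : G.EdgeAt v => (x.1 : V)) hj).symm
        rw [this, Finset.card_map, Finset.card_univ, Fintype.card_fin]
      · rw [Multiset.count_eq_zero_of_notMem fun h => hw (G.incl _ h w (Sym2.mem_mk_right v w))]
        symm
        rw [Multiset.card_eq_zero, Multiset.filter_eq_nil]
        rintro x - rfl
        exact hw x.1.2
    · rw [Multiset.count_filter_of_pos (by simpa using hve)]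
      simp only [Nat.left_eq_add, Multiset.card_eq_zero, Multiset.filter_eq_nil]
      rintro x - rfl
      exact hve (Sym2.mem_mk_left _ _)
  within := by
    intro a b h
    obtain ⟨h1, h2⟩ := Multiset.mem_filter.1 h
    have h3 := within_edges G a b h1
    exact ⟨Finset.mem_erase.2 ⟨by rintro rfl; exact h2 (Sym2.mem_mk_left _ _), h3.1⟩,
      Finset.mem_erase.2 ⟨by rintro rfl; exact h2 (Sym2.mem_mk_right _ _), h3.2⟩⟩
  ends_mem := by
    rintro ⟨⟨w, hw⟩, i⟩
    refine Finset.mem_erase.2 ⟨?_, hw⟩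
    intro hwv
    have hi : 0 < G.edges.count s(v, w) := i.pos
    rw [show w = v from hwv] at hi
    exact hG ⟨v, hv, Multiset.count_pos.1 hi⟩

theorem applyTransition_edges (G : Multigraph V) (hG : ¬ G.HasLoop) (v : V)
    (τ : Finset (Sym2 (G.EdgeAt v))) :
    (G.applyTransition hG v τ).edges = (G.edges.filter fun e => v ∉ e) +
      τ.val.map (Sym2.map fun x : G.EdgeAt v => (x.1 : V)) := rfl

theorem applyTransition_verts (G : Multigraph V) (hG : ¬ G.HasLoop) (v : V)
    (τ : Finset (Sym2 (G.EdgeAt v))) : (G.applyTransition hG v τ).verts = G.verts.erase v := rfl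

theorem isRegular_applyTransition {k : ℕ} {G : Multigraph V} (hreg : G.IsRegular (2 * k))
    (hG : ¬ G.HasLoop) {v : V} (hv : v ∈ G.verts) {τ : Finset (Sym2 (G.EdgeAt v))}
    (hτ : τ ∈ G.transitions v) : (G.applyTransition hG v τ).IsRegular (2 * k) := by
  intro u hu
  rw [transitions_eq_pairings] at hτ
  obtain ⟨h1, h2⟩ := Finset.mem_erase.1 hu
  rw [degree_eq_deg, applyTransition_edges, (starAt_of_not_hasLoop hG hv).deg_pairing hτ h1]
  exact hreg u h2

theorem StarAt.starConnected {d : ℕ} {G : Multigraph V} {v : V} {D : Multiset (Sym2 V)} {f : E → V}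
    (h : StarAt G v D f) (hconn : G.EdgeConnected d) :
    StarConnected d (G.verts.erase v) D Finset.univ f := by
  intro Z hZ hne hne'
  rw [← h.cut_eq fun hv => by simpa using hZ hv]
  exact hconn Z (hZ.trans (Finset.erase_subset _ _)) hne
    (hne'.mono (Finset.sdiff_subset_sdiff (Finset.erase_subset _ _) subset_rfl))

theorem StarAt.even_starCut {k : ℕ} {G : Multigraph V} {v : V} {D : Multiset (Sym2 V)} {f : E → V}
    (h : StarAt G v D f) (hreg : G.IsRegular (2 * k)) :
    ∀ Z ⊆ G.verts.erase v, Even (starCut D Finset.univ f Z) := by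
  intro Z hZ
  rw [← h.cut_eq fun hv => by simpa using hZ hv]
  exact even_cut hreg (hZ.trans (Finset.erase_subset _ _))

theorem StarAt.count_loop {G : Multigraph V} {v : V} {D : Multiset (Sym2 V)} {f : E → V}
    (h : StarAt G v D f) : G.edges.count s(v, v) = 0 := by
  rw [h.edges_eq, Multiset.count_eq_zero, Multiset.mem_add, not_or]
  constructor
  · intro h1
    simpa using (h.within v v h1).1
  · intro h1
    obtain ⟨e, -, he⟩ := Multiset.mem_map.1 h1
    have := h.ends_mem e
    rw [Sym2.congr_right.1 he] at this
    simp at this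

theorem StarAt.card_eq {k : ℕ} {G : Multigraph V} {v : V} {D : Multiset (Sym2 V)} {f : E → V}
    (h : StarAt G v D f) (hreg : G.IsRegular (2 * k)) : Fintype.card E = 2 * k := by
  rw [← h.cut_center, ← hreg v h.mem, degree_eq_deg, deg_eq_cut_add, h.count_loop, mul_zero, add_zero]

/-- A vertex of a `2 * k`-edge connected graph has at least `k!` transitions that preserve the edge
connectivity. -/
theorem StarAt.factorial_le {k : ℕ} {G : Multigraph V} {v : V} {D : Multiset (Sym2 V)} {f : E → V}
    (h : StarAt G v D f) (hreg : G.IsRegular (2 * k)) (hconn : G.EdgeConnected (2 * k))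
    (P : Finset (Sym2 E) → Prop) [DecidablePred P]
    (hP : ∀ τ ∈ pairings Finset.univ,
      Connected (2 * k) (G.verts.erase v) (D + τ.val.map (Sym2.map f)) → P τ) :
    k ! ≤ ((pairings Finset.univ).filter P).card :=
  factorial_le_card_filter_pairings k D Finset.univ h.within (fun e _ => h.ends_mem e)
    (h.starConnected hconn) (h.even_starCut hreg) (h.card_eq hreg) P hP

/-- Strict form for cyclically connected graphs. -/
theorem StarAt.factorial_lt {k : ℕ} {G : Multigraph V} {v : V} {D : Multiset (Sym2 V)} {f : E → V}
    (h : StarAt G v D f) (hreg : G.IsRegular (2 * k)) (hcyc : G.CyclicallyConnected k)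
    (hn : 4 ≤ G.verts.card) (P : Finset (Sym2 E) → Prop) [DecidablePred P]
    (hP : ∀ τ ∈ pairings Finset.univ,
      Connected (2 * k) (G.verts.erase v) (D + τ.val.map (Sym2.map f)) → P τ) :
    k ! < ((pairings Finset.univ).filter P).card := by
  obtain ⟨hconn, hcyc⟩ := hcyc
  have hE := h.card_eq hreg
  -- no neighbour is joined to `v` by `k` or more edges
  have hmult : ∀ w ∈ G.verts.erase v, endsIn Finset.univ f {w} < k := by
    intro w hw
    by_contra! hk
    have hwv := Finset.ne_of_mem_erase hw
    have hZ : cut G.edges ((G.verts.erase v) \ {w}) =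
        starCut D Finset.univ f ((G.verts.erase v) \ {w}) := h.cut_eq (by simp)
    have h1 : cut G.edges {w} = starCut D Finset.univ f {w} := h.cut_eq (by simpa using hwv.symm)
    have h2 := endsIn_compl (W := G.verts.erase v) (S := Finset.univ) (f := f)
      (fun e _ => h.ends_mem e) {w}
    have h3 : cut D (G.verts.erase v \ {w}) = cut D {w} := cut_compl h.within
    have h4 : cut G.edges {w} ≤ 2 * k := by
      rw [← hreg w (Finset.mem_of_mem_erase hw), degree_eq_deg, deg_eq_cut_add]
      omega
    rw [Finset.card_univ, hE] at h2
    have hcard : (G.verts.erase v \ {w}).card + 2 = G.verts.card := by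
      rw [Finset.sdiff_singleton_eq_erase, ← Finset.card_erase_add_one h.mem,
        ← Finset.card_erase_add_one hw]
    have hv' : G.verts \ (G.verts.erase v \ {w}) = {v, w} := by
      ext x
      simp only [Finset.mem_sdiff, Finset.mem_erase, Finset.mem_singleton, Finset.mem_insert]
      have := h.mem
      have := Finset.mem_of_mem_erase hw
      constructor
      · tauto
      · rintro (rfl | rfl) <;> tauto
    have hne : (G.verts.erase v \ {w}).Nonempty := Finset.card_pos.1 (by omega)
    have hsub' : G.verts.erase v \ {w} ⊆ G.verts :=
      Finset.sdiff_subset.trans (Finset.erase_subset _ _)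
    have h5 : 2 * k ≤ cut G.edges (G.verts.erase v \ {w}) :=
      hconn _ hsub' hne (by rw [hv']; simp)
    have h6 : G.cutSize (G.verts.erase v \ {w}) = 2 * k := by
      rw [cutSize_eq_cut]
      simp only [starCut] at *
      omega
    rcases hcyc _ hsub' hne (by rw [hv']; simp) h6 with h7 | h7
    · omega
    · rw [hv', Finset.card_pair hwv.symm] at h7
      omega
  obtain ⟨w, hw⟩ : (G.verts.erase v).Nonempty :=
    Finset.card_pos.1 (by rw [Finset.card_erase_of_mem h.mem]; omega)
  have hk : 0 < k := lt_of_le_of_lt (Nat.zero_le _) (hmult w hw)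
  obtain ⟨j, rfl⟩ := Nat.exists_eq_succ_of_ne_zero hk.ne'
  obtain ⟨a⟩ : Nonempty E := Fintype.card_pos_iff.1 (by omega)
  have ha := Finset.mem_univ a
  have hSC := h.starConnected hconn
  let A := (Finset.univ.erase a).filter fun b => f b ≠ f a
  have hA : j + 2 ≤ A.card := by
    have h1 := hmult (f a) (h.ends_mem a)
    have h4 : endsIn Finset.univ f {f a} =
        1 + ((Finset.univ.erase a).filter fun b => f b = f a).card := by
      rw [endsIn, ← Finset.add_sum_erase _ _ ha, Finset.card_filter]
      simp
    have h5 := Finset.card_filter_add_card_filter_not (s := Finset.univ.erase a)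
      (fun b => f b = f a)
    have h6 := Finset.card_erase_add_one ha
    rw [Finset.card_univ] at h6
    simp only [A, ne_eq]
    omega
  rw [Nat.factorial_succ]
  refine lt_of_lt_of_le (Nat.mul_lt_mul_of_pos_right (show j + 1 < j + 2 by omega)
    j.factorial_pos) ((Nat.mul_le_mul_right _ hA).trans
      (mul_le_card_filter_pairings ha P (Finset.filter_subset _ _) fun b hb => ?_))
  obtain ⟨hbS, hba⟩ := Finset.mem_filter.1 hb
  refine factorial_le_card_filter_pairings (k := j + 1) (W := G.verts.erase v) (f := f) j _ _
    (within_cons h.within (h.ends_mem a) (h.ends_mem b)) (fun e _ => h.ends_mem e) ?_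
    (even_starCut_split (h.even_starCut hreg) ha hbS) ?_ _ fun τ hτ hcon => ?_
  · intro Z hZ hne hne'
    have h1 := starCut_split D f ha hbS Z
    have h2 := hSC Z hZ hne hne'
    split_ifs at h1 with hab
    · have hvZ : v ∉ Z := fun hv => by simpa using hZ hv
      have h3 := h.cut_eq hvZ
      have h4 : G.cutSize Z ≠ 2 * (j + 1) := by
        intro h4
        rcases hcyc Z (hZ.trans (Finset.erase_subset _ _)) hne
          (hne'.mono (Finset.sdiff_subset_sdiff (Finset.erase_subset _ _) subset_rfl)) h4 with h5 | h5
        · obtain ⟨z, rfl⟩ := Finset.card_eq_one.1 h5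
          rw [Finset.mem_singleton, Finset.mem_singleton] at hab
          exact hba (hab.2.trans hab.1.symm)
        · obtain ⟨z, hz⟩ := hne'
          rw [Finset.mem_sdiff, Finset.mem_erase] at hz
          have h6 := Finset.card_le_one.1 h5.le z (Finset.mem_sdiff.2 ⟨hz.1.2, hz.2⟩) v
            (Finset.mem_sdiff.2 ⟨h.mem, hvZ⟩)
          exact hz.1.1 h6
      rw [cutSize_eq_cut] at h4
      obtain ⟨r, hr⟩ := h.even_starCut hreg Z hZ
      omega
    · omega
  · have h1 := Finset.card_erase_add_one hbS
    have h2 := Finset.card_erase_add_one ha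
    rw [Finset.card_univ] at h2
    omega
  · refine hP _ (insert_mem_pairings ha hbS hτ) ?_
    rw [map_insert_pair (pair_notMem_of_mem_pairings hτ), Multiset.add_cons, ← Multiset.cons_add]
    exact hcon

end Star

end Multigraph

namespace Multigraph

section Martin

variable {V : Type*} [DecidableEq V]

theorem martin_of_hasLoop (k : ℕ) (pick : VertexChoice V) {G : Multigraph V} (hG : G.HasLoop) :
    G.martin k pick = 0 := by
  rw [martin, dif_pos hG]

theorem martin_of_card_le_two (k : ℕ) (pick : VertexChoice V) {G : Multigraph V}
    (hG : ¬ G.HasLoop) (hn : G.verts.card ≤ 2) : G.martin k pick = 1 / (k ! : ℚ) := by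
  rw [martin, dif_neg hG, if_pos hn]

theorem martin_of_card_eq_three (k : ℕ) (pick : VertexChoice V) {G : Multigraph V}
    (hG : ¬ G.HasLoop) (hn : G.verts.card = 3) : G.martin k pick = 1 := by
  rw [martin, dif_neg hG, if_neg (by omega), if_pos hn]

theorem martin_of_four_le_card (k : ℕ) (pick : VertexChoice V) {G : Multigraph V}
    (hG : ¬ G.HasLoop) (hn : 4 ≤ G.verts.card) (hne : G.verts.Nonempty) :
    G.martin k pick = ∑ τ ∈ G.transitions (pick G hne).1,
      martin k pick (G.applyTransition hG (pick G hne).1 τ) := by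
  rw [martin, dif_neg hG, if_neg (by omega), if_neg (by omega), dif_pos hne]

theorem cut_singleton_of_not_hasLoop {k : ℕ} {G : Multigraph V} (hreg : G.IsRegular (2 * k))
    (hG : ¬ G.HasLoop) {u : V} (hu : u ∈ G.verts) : cut G.edges {u} = 2 * k := by
  have h1 := hreg u hu
  rw [degree_eq_deg, deg_eq_cut_add,
    Multiset.count_eq_zero.2 fun h => hG ⟨u, hu, h⟩] at h1
  simpa using h1

/-- If the graph is not `2 * k`-edge connected, then its Martin invariant vanishes. -/
theorem martin_eq_zero (k : ℕ) (pick : VertexChoice V) (n : ℕ) :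
    ∀ G : Multigraph V, G.verts.card = n → G.IsRegular (2 * k) →
      ¬ G.EdgeConnected (2 * k) → G.martin k pick = 0 := by
  induction n with
  | zero =>
    intro G hn _ hconn
    refine absurd ?_ hconn
    intro X hX hne
    rw [Finset.card_eq_zero.1 hn, Finset.subset_empty] at hX
    simp [hX] at hne
  | succ n ih =>
    intro G hn hreg hconn
    by_cases hG : G.HasLoop
    · exact martin_of_hasLoop k pick hG
    have hne : G.verts.Nonempty := Finset.card_pos.1 (by omega)
    simp only [EdgeConnected, not_forall, not_le] at hconn
    obtain ⟨X, hX, hX1, hX2, hlt⟩ := hconn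
    have hlt' : cut G.edges (G.verts \ X) < 2 * k := by rwa [cut_compl (within_edges G)]
    have hcard : ∀ Z ⊆ G.verts, Z.Nonempty → cut G.edges Z < 2 * k → 2 ≤ Z.card := by
      intro Z hZ hZne hZc
      by_contra hZ2
      obtain ⟨u, rfl⟩ := Finset.card_eq_one.1 (by have := hZne.card_pos; omega : Z.card = 1)
      rw [cut_singleton_of_not_hasLoop hreg hG (hZ (Finset.mem_singleton_self u))] at hZc
      omega
    have hc1 := hcard X hX hX1 hlt
    have hc2 := hcard _ Finset.sdiff_subset hX2 hlt'
    have hc3 := Finset.card_sdiff_add_card_eq_card hX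
    rw [martin_of_four_le_card k pick hG (by omega) hne]
    set v := (pick G hne).1 with hv
    have hvG : v ∈ G.verts := (pick G hne).2
    refine Finset.sum_eq_zero fun τ hτ => ih _ ?_ (isRegular_applyTransition hreg hG hvG hτ) ?_
    · rw [applyTransition_verts, Finset.card_erase_of_mem hvG]
      omega
    obtain ⟨Z, hZ, hvZ, hZ1, hZ2, hZc⟩ : ∃ Z ⊆ G.verts, v ∉ Z ∧ Z.Nonempty ∧
        2 ≤ (G.verts \ Z).card ∧ cut G.edges Z < 2 * k := by
      by_cases hvX : v ∈ X
      · exact ⟨G.verts \ X, Finset.sdiff_subset, by simp [hvX], hX2,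
          by rwa [Finset.sdiff_sdiff_eq_self hX], hlt'⟩
      · exact ⟨X, hX, hvX, hX1, hc2, hlt⟩
    intro hcon
    rw [transitions_eq_pairings] at hτ
    have h1 := hcon Z (by
      rw [applyTransition_verts]
      exact fun z hz => Finset.mem_erase.2 ⟨by rintro rfl; exact hvZ hz, hZ hz⟩) hZ1 (by
      rw [applyTransition_verts, ← Finset.card_pos, Finset.erase_sdiff_comm,
        Finset.card_erase_of_mem (Finset.mem_sdiff.2 ⟨hvG, hvZ⟩)]
      omega)
    have h2 := (starAt_of_not_hasLoop hG hvG).cut_pairing_add hτ hvZ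
    rw [cutSize_eq_cut, applyTransition_edges] at h1
    omega

open Classical in
/-- The transitions at `v` that preserve `2 * k`-edge connectedness. -/
noncomputable def goodTransitions (k : ℕ) (G : Multigraph V) (hG : ¬ G.HasLoop) (v : V) :
    Finset (Finset (Sym2 (G.EdgeAt v))) :=
  (G.transitions v).filter fun τ => (G.applyTransition hG v τ).EdgeConnected (2 * k)

theorem mem_goodTransitions {k : ℕ} {G : Multigraph V} {hG : ¬ G.HasLoop} {v : V}
    {τ : Finset (Sym2 (G.EdgeAt v))} : τ ∈ goodTransitions k G hG v ↔
      τ ∈ G.transitions v ∧ (G.applyTransition hG v τ).EdgeConnected (2 * k) := by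
  classical
  rw [goodTransitions, Finset.mem_filter]

theorem martin_eq_sum_goodTransitions {k : ℕ} (pick : VertexChoice V) {G : Multigraph V}
    (hreg : G.IsRegular (2 * k)) (hG : ¬ G.HasLoop) (hn : 4 ≤ G.verts.card)
    (hne : G.verts.Nonempty) :
    G.martin k pick = ∑ τ ∈ goodTransitions k G hG (pick G hne).1,
      martin k pick (G.applyTransition hG (pick G hne).1 τ) := by
  classical
  rw [martin_of_four_le_card k pick hG hn hne, goodTransitions]
  symm
  refine Finset.sum_subset (Finset.filter_subset _ _) fun τ hτ hτ' => ?_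
  refine martin_eq_zero k pick _ _ rfl (isRegular_applyTransition hreg hG (pick G hne).2 hτ) ?_
  intro h
  exact hτ' (Finset.mem_filter.2 ⟨hτ, h⟩)

theorem factorial_le_card_goodTransitions {k : ℕ} {G : Multigraph V}
    (hreg : G.IsRegular (2 * k)) (hconn : G.EdgeConnected (2 * k)) (hG : ¬ G.HasLoop)
    {v : V} (hv : v ∈ G.verts) : k ! ≤ (goodTransitions k G hG v).card := by
  classical
  rw [goodTransitions, transitions_eq_pairings]
  exact (starAt_of_not_hasLoop hG hv).factorial_le hreg hconn _ fun τ _ h => h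

theorem factorial_lt_card_goodTransitions {k : ℕ} {G : Multigraph V}
    (hreg : G.IsRegular (2 * k)) (hcyc : G.CyclicallyConnected k) (hn : 4 ≤ G.verts.card)
    (hG : ¬ G.HasLoop) {v : V} (hv : v ∈ G.verts) : k ! < (goodTransitions k G hG v).card := by
  classical
  rw [goodTransitions, transitions_eq_pairings]
  exact (starAt_of_not_hasLoop hG hv).factorial_lt hreg hcyc hn _ fun τ _ h => h

theorem factorial_zpow_succ (k n : ℕ) :
    (k ! : ℚ) ^ (((n + 1 : ℕ) : ℤ) - 3) = k ! * (k ! : ℚ) ^ ((n : ℤ) - 3) := by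
  have h : (k ! : ℚ) ≠ 0 := by exact_mod_cast k.factorial_ne_zero
  rw [← zpow_one_add₀ h]
  congr 1
  push_cast
  ring

theorem factorial_zpow_pos (k : ℕ) (n : ℤ) : 0 < (k ! : ℚ) ^ n :=
  zpow_pos (by exact_mod_cast k.factorial_pos) _

theorem martin_of_card_eq_two {k : ℕ} (pick : VertexChoice V) {G : Multigraph V}
    (hG : ¬ G.HasLoop) (hn : G.verts.card = 2) :
    G.martin k pick = (k ! : ℚ) ^ ((G.verts.card : ℤ) - 3) := by
  rw [martin_of_card_le_two k pick hG hn.le, hn]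
  norm_num [zpow_neg]

theorem le_martin (k : ℕ) (pick : VertexChoice V) (n : ℕ) :
    ∀ G : Multigraph V, G.verts.card = n → 2 ≤ n → G.IsRegular (2 * k) →
      G.EdgeConnected (2 * k) → (k ! : ℚ) ^ ((n : ℤ) - 3) ≤ G.martin k pick := by
  induction n with
  | zero => intro G _ h; omega
  | succ n ih =>
    intro G hn h2 hreg hconn
    have hG := not_hasLoop_of_connected hreg hconn (by omega)
    rcases (by omega : n + 1 = 2 ∨ n + 1 = 3 ∨ 4 ≤ n + 1) with h | h | h
    · rw [martin_of_card_eq_two pick hG (by omega), hn]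
    · rw [martin_of_card_eq_three k pick hG (by omega), h]
      simp
    · have hne : G.verts.Nonempty := Finset.card_pos.1 (by omega)
      rw [martin_eq_sum_goodTransitions pick hreg hG (by omega) hne, factorial_zpow_succ]
      have hB := factorial_zpow_pos k ((n : ℤ) - 3)
      have h1 := factorial_le_card_goodTransitions hreg hconn hG (pick G hne).2
      calc (k ! : ℚ) * (k ! : ℚ) ^ ((n : ℤ) - 3)
          ≤ (goodTransitions k G hG (pick G hne).1).card • (k ! : ℚ) ^ ((n : ℤ) - 3) := by
            rw [nsmul_eq_mul]
            exact mul_le_mul_of_nonneg_right (by exact_mod_cast h1) hB.le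
        _ ≤ _ := Finset.card_nsmul_le_sum _ _ _ fun τ hτ => by
            obtain ⟨h3, h4⟩ := mem_goodTransitions.1 hτ
            refine ih _ ?_ (by omega) (isRegular_applyTransition hreg hG (pick G hne).2 h3) h4
            rw [applyTransition_verts, Finset.card_erase_of_mem (pick G hne).2]
            omega

theorem le_martin_applyTransition {k n : ℕ} (pick : VertexChoice V) {G : Multigraph V}
    (hreg : G.IsRegular (2 * k)) (hG : ¬ G.HasLoop) (hn : G.verts.card = n + 1) (h2 : 3 ≤ n)
    {v : V} (hv : v ∈ G.verts) {τ : Finset (Sym2 (G.EdgeAt v))}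
    (hτ : τ ∈ goodTransitions k G hG v) :
    (k ! : ℚ) ^ ((n : ℤ) - 3) ≤ (G.applyTransition hG v τ).martin k pick := by
  obtain ⟨h3, h4⟩ := mem_goodTransitions.1 hτ
  refine le_martin k pick n _ ?_ (by omega) (isRegular_applyTransition hreg hG hv h3) h4
  rw [applyTransition_verts, Finset.card_erase_of_mem hv]
  omega

theorem martin_eq_iff {k n : ℕ} (pick : VertexChoice V) {G : Multigraph V}
    (hreg : G.IsRegular (2 * k)) (hconn : G.EdgeConnected (2 * k)) (hG : ¬ G.HasLoop)
    (hn : G.verts.card = n + 1) (h2 : 3 ≤ n) (hne : G.verts.Nonempty) :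
    G.martin k pick = (k ! : ℚ) ^ (((n + 1 : ℕ) : ℤ) - 3) ↔
      (goodTransitions k G hG (pick G hne).1).card = k ! ∧
      ∀ τ ∈ goodTransitions k G hG (pick G hne).1,
        (G.applyTransition hG (pick G hne).1 τ).martin k pick = (k ! : ℚ) ^ ((n : ℤ) - 3) := by
  rw [martin_eq_sum_goodTransitions pick hreg hG (by omega) hne, factorial_zpow_succ]
  have hB := factorial_zpow_pos k ((n : ℤ) - 3)
  have h1 := factorial_le_card_goodTransitions hreg hconn hG (pick G hne).2
  have h3 := fun τ hτ => le_martin_applyTransition pick hreg hG hn h2 (pick G hne).2 (τ := τ) hτ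
  set N := goodTransitions k G hG (pick G hne).1
  constructor
  · intro h
    have h4 : (N.card : ℚ) * (k ! : ℚ) ^ ((n : ℤ) - 3) ≤
        k ! * (k ! : ℚ) ^ ((n : ℤ) - 3) := by
      rw [← h, ← nsmul_eq_mul]
      exact Finset.card_nsmul_le_sum _ _ _ h3
    have h5 : N.card = k ! :=
      le_antisymm (by exact_mod_cast le_of_mul_le_mul_right h4 hB) h1
    refine ⟨h5, fun τ hτ => ?_⟩
    refine (((Finset.sum_eq_sum_iff_of_le h3).1 ?_) τ hτ).symm
    rw [h, Finset.sum_const, h5, nsmul_eq_mul]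
  · rintro ⟨h4, h5⟩
    rw [Finset.sum_congr rfl h5, Finset.sum_const, h4, nsmul_eq_mul]

theorem lt_martin {k : ℕ} (pick : VertexChoice V) {G : Multigraph V}
    (hreg : G.IsRegular (2 * k)) (hcyc : G.CyclicallyConnected k) (hn : 4 ≤ G.verts.card) :
    (k ! : ℚ) ^ ((G.verts.card : ℤ) - 3) < G.martin k pick := by
  have hG := not_hasLoop_of_connected hreg hcyc.1 (by omega)
  have hne : G.verts.Nonempty := Finset.card_pos.1 (by omega)
  obtain ⟨n, hn'⟩ := Nat.exists_eq_add_of_le' (by omega : 1 ≤ G.verts.card)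
  refine lt_of_le_of_ne (le_martin k pick _ G rfl (by omega) hreg hcyc.1) fun h => ?_
  rw [hn', eq_comm, martin_eq_iff pick hreg hcyc.1 hG hn' (by omega) hne] at h
  exact (factorial_lt_card_goodTransitions hreg hcyc hn hG (pick G hne).2).ne' h.1

end Martin

end Multigraph

namespace Multigraph

section Collapse

variable {V : Type*} [DecidableEq V] {E : Type*} [Fintype E] [DecidableEq E]

theorem ext_of_eq {G H : Multigraph V} (hv : G.verts = H.verts) (he : G.edges = H.edges) :
    G = H := by
  cases G; cases H
  cases hv; cases he
  rfl

/-- The map that sends the vertices in `Y` to `y` and fixes the others. -/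
def retract (Y : Finset V) (y : V) (a : V) : V := if a ∈ Y then y else a

/-- The edges that remain when `Y` is replaced by the vertex `y`. -/
def collapseEdges (D : Multiset (Sym2 V)) (Y : Finset V) (y : V) : Multiset (Sym2 V) :=
  (D.filter fun e => ¬ e.toFinset ⊆ Y).map (Sym2.map (retract Y y))

theorem collapse_edges (G : Multigraph V) (Y : Finset V) (y : V) :
    (G.collapse Y y).edges = collapseEdges G.edges Y y := rfl

theorem collapse_verts (G : Multigraph V) (Y : Finset V) (y : V) :
    (G.collapse Y y).verts = insert y (G.verts \ Y) := rfl

theorem toFinset_mk_subset_iff (a b : V) (Y : Finset V) :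
    s(a, b).toFinset ⊆ Y ↔ a ∈ Y ∧ b ∈ Y := by
  simp [Finset.subset_iff, Sym2.mem_toFinset]

@[simp] theorem collapseEdges_zero (Y : Finset V) (y : V) : collapseEdges 0 Y y = 0 := rfl

theorem collapseEdges_add (D D' : Multiset (Sym2 V)) (Y : Finset V) (y : V) :
    collapseEdges (D + D') Y y = collapseEdges D Y y + collapseEdges D' Y y := by
  rw [collapseEdges, Multiset.filter_add, Multiset.map_add]
  rfl

theorem collapseEdges_singleton (a b : V) (Y : Finset V) (y : V) :
    collapseEdges {s(a, b)} Y y =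
      if a ∈ Y ∧ b ∈ Y then 0 else {s(retract Y y a, retract Y y b)} := by
  rw [collapseEdges, Multiset.filter_singleton]
  simp only [toFinset_mk_subset_iff]
  split_ifs <;> simp_all

theorem collapseEdges_cons (a b : V) (D : Multiset (Sym2 V)) (Y : Finset V) (y : V) :
    collapseEdges (s(a, b) ::ₘ D) Y y =
      (if a ∈ Y ∧ b ∈ Y then 0 else {s(retract Y y a, retract Y y b)}) + collapseEdges D Y y := by
  rw [← Multiset.singleton_add, collapseEdges_add, collapseEdges_singleton]

theorem collapseEdges_map_val {ι : Type*} (S : Finset ι) (g : ι → Sym2 V) (Y : Finset V) (y : V) :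
    collapseEdges (S.val.map g) Y y = ∑ x ∈ S, collapseEdges {g x} Y y := by
  classical
  induction S using Finset.induction_on with
  | empty => simp
  | insert a S ha ih =>
    rw [Finset.sum_insert ha, Finset.insert_val_of_notMem ha, Multiset.map_cons,
      ← Multiset.singleton_add, collapseEdges_add, ih]

theorem cut_collapseEdges {Y : Finset V} {y : V} {Z Z' : Finset V}
    (h : ∀ a, a ∈ Z' ↔ retract Y y a ∈ Z) (D : Multiset (Sym2 V)) :
    cut (collapseEdges D Y y) Z = cut D Z' := by
  induction D using edges_induction with
  | h0 => simp
  | hs a b D ih =>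
    rw [collapseEdges_cons, cut_add, ih, cut_cons]
    congr 1
    simp only [h]
    split_ifs with h1 h2 h2
    · simp
    · simp [retract, h1.1, h1.2] at h2
    · rw [cut_singleton, if_pos h2]
    · rw [cut_singleton, if_neg h2]

theorem mem_iff_retract_mem_of_notMem {Y Z : Finset V} {y : V} (hZ : Disjoint Z Y) (hy : y ∉ Z)
    (a : V) : a ∈ Z ↔ retract Y y a ∈ Z := by
  rw [retract]
  split_ifs with h
  · exact ⟨fun h' => absurd h (Finset.disjoint_left.1 hZ h'), fun h' => absurd h' hy⟩
  · rfl

theorem mem_union_iff_retract_mem {Y Z : Finset V} {y : V} (hy : y ∈ Z)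
    (a : V) : a ∈ Z ∪ Y ↔ retract Y y a ∈ Z := by
  rw [retract, Finset.mem_union]
  split_ifs with h
  · simp [h, hy]
  · simp [h]

/-- Collapsing preserves edge connectivity. -/
theorem connected_collapse {d : ℕ} {W Y : Finset V} {y : V} {D D' : Multiset (Sym2 V)}
    (hY : Y ⊆ W) (hy : y ∈ Y) (hconn : Connected d W D)
    (hcut : ∀ Z Z' : Finset V, (∀ a, a ∈ Z' ↔ retract Y y a ∈ Z) → cut D' Z = cut D Z') :
    Connected d (insert y (W \ Y)) D' := by
  intro Z hZ hne ⟨u, hu⟩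
  rw [Finset.mem_sdiff] at hu
  have hZW : Z ⊆ W := hZ.trans (Finset.insert_subset (hY hy) Finset.sdiff_subset)
  by_cases hyZ : y ∈ Z
  · rw [hcut Z _ (mem_union_iff_retract_mem hyZ)]
    refine hconn _ (Finset.union_subset hZW hY) ⟨y, Finset.mem_union_left _ hyZ⟩ ⟨u, ?_⟩
    rcases Finset.mem_insert.1 hu.1 with rfl | h
    · exact absurd hyZ hu.2
    · rw [Finset.mem_sdiff] at h ⊢
      exact ⟨h.1, by simp [hu.2, h.2]⟩
  · have hdis : Disjoint Z Y := Finset.disjoint_left.2 fun z hz hzY => by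
      rcases Finset.mem_insert.1 (hZ hz) with rfl | h
      · exact hyZ hz
      · exact (Finset.mem_sdiff.1 h).2 hzY
    rw [hcut Z _ (mem_iff_retract_mem_of_notMem hdis hyZ)]
    exact hconn _ hZW hne ⟨y, Finset.mem_sdiff.2 ⟨hY hy, hyZ⟩⟩

theorem edgeConnected_collapse {d : ℕ} {G : Multigraph V} {Y : Finset V} {y : V}
    (hY : Y ⊆ G.verts) (hy : y ∈ Y) (hconn : G.EdgeConnected d) :
    (G.collapse Y y).EdgeConnected d :=
  connected_collapse hY hy hconn fun _ _ h => cut_collapseEdges h _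

theorem deg_collapseEdges_of_notMem {Y : Finset V} {y u : V} (hy : y ∈ Y) (hu : u ∉ Y)
    (D : Multiset (Sym2 V)) : deg (collapseEdges D Y y) u = deg D u := by
  have hr : ∀ a, retract Y y a = u ↔ a = u := fun a => by
    rw [retract]
    split_ifs with h
    · exact ⟨by rintro rfl; exact absurd hy hu, by rintro rfl; exact absurd h hu⟩
    · rfl
  induction D using edges_induction with
  | h0 => simp
  | hs a b D ih =>
    rw [collapseEdges_cons, deg_add, ih, deg_cons]
    congr 1
    split_ifs with h1 h2 h3 h3 <;> simp_all

theorem deg_collapseEdges_self {Y : Finset V} {y : V} (hy : y ∈ Y)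
    (D : Multiset (Sym2 V)) : deg (collapseEdges D Y y) y = cut D Y := by
  have hr : ∀ a, retract Y y a = y ↔ a ∈ Y := fun a => by
    rw [retract]
    split_ifs with h
    · simp [h]
    · exact ⟨by rintro rfl; exact hy, fun h' => absurd h' h⟩
  induction D using edges_induction with
  | h0 => simp
  | hs a b D ih =>
    rw [collapseEdges_cons, deg_add, ih, cut_cons]
    congr 1
    by_cases h1 : a ∈ Y <;> by_cases h2 : b ∈ Y <;> simp [h1, h2, hr]

theorem isRegular_collapse {k : ℕ} {G : Multigraph V} {Y : Finset V} {y : V} (hy : y ∈ Y)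
    (hreg : G.IsRegular (2 * k)) (hcut : G.cutSize Y = 2 * k) :
    (G.collapse Y y).IsRegular (2 * k) := by
  intro u hu
  rw [degree_eq_deg, collapse_edges]
  rcases Finset.mem_insert.1 hu with rfl | hu
  · rw [deg_collapseEdges_self hy, ← cutSize_eq_cut, hcut]
  · rw [Finset.mem_sdiff] at hu
    rw [deg_collapseEdges_of_notMem hy hu.2]
    exact hreg u hu.1

theorem retract_mem {Y W : Finset V} {y a : V} (ha : a ∈ W) :
    retract Y y a ∈ insert y (W \ Y) := by
  rw [retract]
  split_ifs with h <;> simp [h, ha]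

theorem within_collapseEdges {Y W : Finset V} {y : V} {D : Multiset (Sym2 V)} (hD : Within W D) :
    Within (insert y (W \ Y)) (collapseEdges D Y y) := by
  induction D using edges_induction with
  | h0 => intro a b h; simp at h
  | hs a b D ih =>
    have hab := hD a b (Multiset.mem_cons_self _ _)
    replace ih := ih fun c d h => hD c d (Multiset.mem_cons_of_mem h)
    rw [collapseEdges_cons]
    split_ifs
    · rwa [zero_add]
    · rw [Multiset.singleton_add]
      exact within_cons ih (retract_mem hab.1) (retract_mem hab.2)

theorem StarAt.collapse {G : Multigraph V} {v : V} {D : Multiset (Sym2 V)} {f : E → V}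
    (h : StarAt G v D f) {Y : Finset V} {y : V} (hv : v ∉ Y) (hy : y ∈ Y) :
    StarAt (G.collapse Y y) v (collapseEdges D Y y) (fun e => retract Y y (f e)) := by
  have hW : (G.collapse Y y).verts.erase v = insert y (G.verts.erase v \ Y) := by
    rw [collapse_verts, Finset.erase_insert_of_ne (by rintro rfl; exact hv hy),
      Finset.erase_sdiff_comm]
  refine ⟨?_, ?_, ?_, ?_⟩
  · rw [collapse_verts]
    exact Finset.mem_insert_of_mem (Finset.mem_sdiff.2 ⟨h.mem, hv⟩)
  · rw [collapse_edges, h.edges_eq, collapseEdges_add, collapseEdges]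
    congr 1
    rw [collapseEdges, Multiset.filter_eq_self.2, Multiset.map_map]
    · refine Multiset.map_congr rfl fun e _ => ?_
      rw [Function.comp_apply, Sym2.map_mk]
      congr 2
      simp [retract, hv]
    · intro p hp
      obtain ⟨e, -, rfl⟩ := Multiset.mem_map.1 hp
      rw [toFinset_mk_subset_iff]
      exact fun h => hv h.1
  · rw [hW]
    exact within_collapseEdges h.within
  · intro e
    rw [hW]
    exact retract_mem (h.ends_mem e)

theorem collapseEdges_pairing {Y : Finset V} {y : V} {f : E → V} {τ : Finset (Sym2 E)}
    (hτ : ∀ p ∈ τ, ¬ (Sym2.map f p).toFinset ⊆ Y) :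
    collapseEdges (τ.val.map (Sym2.map f)) Y y =
      τ.val.map (Sym2.map fun e => retract Y y (f e)) := by
  rw [collapseEdges, Multiset.filter_eq_self.2, Multiset.map_map]
  · refine Multiset.map_congr rfl fun p _ => ?_
    rw [Function.comp_apply, Sym2.map_map]
    rfl
  · intro q hq
    obtain ⟨p, hp, rfl⟩ := Multiset.mem_map.1 hq
    exact hτ p hp

theorem cut_map_pairing_retract {Y : Finset V} {y : V} {Z Z' : Finset V}
    (h : ∀ a, a ∈ Z' ↔ retract Y y a ∈ Z) (f : E → V) (τ : Finset (Sym2 E)) :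
    cut (τ.val.map (Sym2.map fun e => retract Y y (f e))) Z = cut (τ.val.map (Sym2.map f)) Z' := by
  rw [cut_map_val, cut_map_val]
  refine Finset.sum_congr rfl fun p _ => ?_
  induction p using Sym2.ind with
  | _ a b => simp only [Sym2.map_mk, cut_singleton, h]

/-- If the transition pairs no two edges that leave `X`, then collapsing the rest of `X` after the
transition is the same as collapsing `X`. -/
theorem StarAt.collapseEdges_erase {G : Multigraph V} {v : V} {D : Multiset (Sym2 V)} {f : E → V}
    (h : StarAt G v D f) {X : Finset V} {x : V} (hv : v ∈ X)
    {τ : Finset (Sym2 E)} (hτ : τ ∈ pairings Finset.univ)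
    (hX : ∀ a b, s(a, b) ∈ τ → f a ∈ X ∨ f b ∈ X) :
    collapseEdges (D + τ.val.map (Sym2.map f)) (X.erase v) x = collapseEdges G.edges X x := by
  have hr : ∀ a, a ≠ v → retract (X.erase v) x a = retract X x a := fun a ha => by
    simp [retract, ha]
  have hfv : ∀ e, f e ≠ v := fun e => Finset.ne_of_mem_erase (h.ends_mem e)
  have hrv : retract X x v = x := if_pos hv
  rw [h.edges_eq, collapseEdges_add, collapseEdges_add]
  congr 1
  · have hv' : ∀ e ∈ D, ∀ a ∈ e, a ≠ v := by
      intro e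
      induction e using Sym2.ind with
      | _ a b =>
        intro he c hc
        have hab := h.within a b he
        rcases Sym2.mem_iff.1 hc with rfl | rfl
        · exact Finset.ne_of_mem_erase hab.1
        · exact Finset.ne_of_mem_erase hab.2
    rw [collapseEdges, collapseEdges]
    have hf : (D.filter fun e => ¬ e.toFinset ⊆ X.erase v) =
        D.filter fun e => ¬ e.toFinset ⊆ X := by
      refine Multiset.filter_congr fun e he => not_congr ?_
      rw [Finset.subset_erase]
      exact and_iff_left fun h' => hv' e he v (Sym2.mem_toFinset.1 h') rfl
    rw [hf]
    refine Multiset.map_congr rfl fun e he => Sym2.map_congr fun a ha => ?_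
    exact hr a (hv' e (Multiset.mem_of_mem_filter he) a ha)
  · rw [collapseEdges_map_val, collapseEdges_map_val]
    refine sum_over_pairing _ _ _ τ hτ fun a b hab => ?_
    have := hX a b hab
    simp only [Sym2.map_mk, collapseEdges_singleton, hr _ (hfv a), hr _ (hfv b), hv, hrv, true_and,
      Finset.mem_erase, ne_eq, hfv, not_false_eq_true]
    by_cases h1 : f a ∈ X <;> by_cases h2 : f b ∈ X
    · simp [h1, h2]
    · simp [h1, h2, retract]
    · simp [h1, h2, retract, Sym2.eq_swap]
    · simp [h1, h2] at this

end Collapse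

section Relabel

variable {V : Type*} [DecidableEq V]

/-- The graph with vertices renamed by a permutation. -/
def relabel (σ : Equiv.Perm V) (G : Multigraph V) : Multigraph V where
  verts := G.verts.image σ
  edges := G.edges.map (Sym2.map σ)
  incl := by
    intro e he a ha
    obtain ⟨e', he', rfl⟩ := Multiset.mem_map.1 he
    obtain ⟨b, hb, rfl⟩ := Sym2.mem_map.1 ha
    exact Finset.mem_image_of_mem _ (G.incl e' he' b hb)

theorem cut_relabel (σ : Equiv.Perm V) (D : Multiset (Sym2 V)) (Z : Finset V) :
    cut (D.map (Sym2.map σ)) (Z.image σ) = cut D Z := by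
  induction D using edges_induction with
  | h0 => simp
  | hs a b D ih =>
    rw [Multiset.map_cons, Sym2.map_mk, cut_cons, ih, cut_cons]
    simp only [σ.injective.mem_finset_image]

theorem relabel_cutSize (σ : Equiv.Perm V) (G : Multigraph V) (Z : Finset V) :
    (relabel σ G).cutSize (Z.image σ) = G.cutSize Z := cut_relabel σ G.edges Z

theorem exists_image_eq (σ : Equiv.Perm V) {W Z : Finset V} (hZ : Z ⊆ W.image σ) :
    ∃ Z' ⊆ W, Z'.image σ = Z := by
  obtain ⟨Z', hZ', rfl⟩ := Finset.subset_image_iff.1 hZ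
  exact ⟨Z', hZ', rfl⟩

theorem cyclicallyConnected_relabel {k : ℕ} (σ : Equiv.Perm V) {G : Multigraph V}
    (hG : G.CyclicallyConnected k) : (relabel σ G).CyclicallyConnected k := by
  have hs : ∀ Z, (relabel σ G).verts \ Z.image σ = (G.verts \ Z).image σ := fun Z =>
    (Finset.image_sdiff _ _ σ.injective).symm
  constructor
  · intro Z hZ hne hne'
    obtain ⟨Z', hZ', rfl⟩ := exists_image_eq σ hZ
    rw [hs, Finset.image_nonempty] at hne'
    rw [relabel_cutSize]
    exact hG.1 Z' hZ' (Finset.image_nonempty.1 hne) hne'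
  · intro Z hZ hne hne'
    obtain ⟨Z', hZ', rfl⟩ := exists_image_eq σ hZ
    rw [hs, Finset.image_nonempty] at hne'
    rw [relabel_cutSize, hs, Finset.card_image_of_injective _ σ.injective,
      Finset.card_image_of_injective _ σ.injective]
    exact hG.2 Z' hZ' (Finset.image_nonempty.1 hne) hne'

theorem relabel_collapse (σ : Equiv.Perm V) (G : Multigraph V) (Y : Finset V) (y : V) :
    relabel σ (G.collapse Y y) = (relabel σ G).collapse (Y.image σ) (σ y) := by
  refine ext_of_eq ?_ ?_
  · change (insert y (G.verts \ Y)).image σ = insert (σ y) (G.verts.image σ \ Y.image σ)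
    rw [Finset.image_insert, Finset.image_sdiff _ _ σ.injective]
  · change (collapseEdges G.edges Y y).map (Sym2.map σ) =
      collapseEdges (G.edges.map (Sym2.map σ)) (Y.image σ) (σ y)
    induction G.edges using edges_induction with
    | h0 => simp
    | hs a b D ih =>
      have hr : ∀ a, retract (Y.image σ) (σ y) (σ a) = σ (retract Y y a) := fun a => by
        simp only [retract, σ.injective.mem_finset_image]
        split_ifs <;> rfl
      rw [Multiset.map_cons, Sym2.map_mk, collapseEdges_cons, collapseEdges_cons, Multiset.map_add,
        ih]
      simp only [hr, σ.injective.mem_finset_image]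
      congr 1
      split_ifs <;> simp

theorem isDecomposition_relabel {k : ℕ} (σ : Equiv.Perm V) {G : Multigraph V}
    {L : List (Multigraph V)} (h : IsDecomposition k G L) :
    IsDecomposition k (relabel σ G) (L.map (relabel σ)) := by
  induction h with
  | single G hn hG =>
    refine .single _ ?_ (cyclicallyConnected_relabel σ hG)
    rwa [relabel, Finset.card_image_of_injective _ σ.injective]
  | cut G X Y hXY hun hX hY hcut x y hx hy L₁ L₂ _ _ ih₁ ih₂ =>
    rw [List.map_append]
    refine .cut _ (X.image σ) (Y.image σ) ((Finset.disjoint_image σ.injective).2 hXY) ?_ ?_ ?_ ?_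
      (σ x) (σ y) (Finset.mem_image_of_mem _ hx) (Finset.mem_image_of_mem _ hy) _ _ ?_ ?_
    · rw [← Finset.image_union, hun]
      rfl
    · rwa [Finset.card_image_of_injective _ σ.injective]
    · rwa [Finset.card_image_of_injective _ σ.injective]
    · rwa [relabel_cutSize]
    · rwa [← relabel_collapse]
    · rwa [← relabel_collapse]

theorem totallyDecomposable_relabel {k : ℕ} (σ : Equiv.Perm V) {G : Multigraph V}
    (h : G.TotallyDecomposable k) : (relabel σ G).TotallyDecomposable k := by
  obtain ⟨L, hL, hL3⟩ := h
  refine ⟨_, isDecomposition_relabel σ hL, fun H hH => ?_⟩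
  obtain ⟨H', hH', rfl⟩ := List.mem_map.1 hH
  rw [relabel, Finset.card_image_of_injective _ σ.injective]
  exact hL3 H' hH'

theorem relabel_swap_collapse (G : Multigraph V) {X : Finset V} {x x' : V} (hx : x ∈ X)
    (hx' : x' ∈ X) : relabel (Equiv.swap x x') (G.collapse X x) = G.collapse X x' := by
  have hsw : ∀ a, a ∉ X → Equiv.swap x x' a = a := fun a ha =>
    Equiv.swap_apply_of_ne_of_ne (by rintro rfl; exact ha hx) (by rintro rfl; exact ha hx')
  refine ext_of_eq ?_ ?_
  · change (insert x (G.verts \ X)).image _ = insert x' (G.verts \ X)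
    rw [Finset.image_insert, Equiv.swap_apply_left]
    congr 1
    rw [Finset.image_congr (g := id), Finset.image_id]
    intro a ha
    exact hsw a (Finset.mem_sdiff.1 ha).2
  · change (collapseEdges G.edges X x).map _ = collapseEdges G.edges X x'
    rw [collapseEdges, collapseEdges, Multiset.map_map]
    refine Multiset.map_congr rfl fun e _ => ?_
    rw [Function.comp_apply, Sym2.map_map]
    congr 1
    funext a
    by_cases ha : a ∈ X
    · simp [retract, ha]
    · simp [retract, ha, hsw a ha]

theorem totallyDecomposable_collapse_congr {k : ℕ} (G : Multigraph V) {X : Finset V} {x x' : V}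
    (hx : x ∈ X) (hx' : x' ∈ X) :
    (G.collapse X x).TotallyDecomposable k ↔ (G.collapse X x').TotallyDecomposable k := by
  constructor
  · intro h
    rw [← relabel_swap_collapse G hx hx']
    exact totallyDecomposable_relabel _ h
  · intro h
    rw [← relabel_swap_collapse G hx' hx]
    exact totallyDecomposable_relabel _ h

end Relabel

end Multigraph

namespace Multigraph

section MinimalStar

variable {V : Type*} [DecidableEq V] {E : Type*} [Fintype E] [DecidableEq E]

/-- The graph with vertices `W` and edges `D` is totally decomposable or has two vertices. -/
def Decomposes (k : ℕ) (W : Finset V) (D : Multiset (Sym2 V)) : Prop :=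
  W.card = 2 ∨ ∃ H : Multigraph V, H.verts = W ∧ H.edges = D ∧ H.TotallyDecomposable k

theorem decomposes_iff {k : ℕ} {H : Multigraph V} (h : 3 ≤ H.verts.card) :
    Decomposes k H.verts H.edges ↔ H.TotallyDecomposable k := by
  constructor
  · rintro (h' | ⟨H', hv, he, hH⟩)
    · omega
    · rwa [← ext_of_eq hv he]
  · exact fun hH => .inr ⟨H, rfl, rfl, hH⟩

open Classical in
/-- Exactly `k!` transitions preserve edge connectivity, and they give decomposable graphs. -/
def MinimalStar (k : ℕ) (W : Finset V) (D : Multiset (Sym2 V)) (f : E → V) : Prop :=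
  ((pairings Finset.univ).filter fun τ =>
      Connected (2 * k) W (D + τ.val.map (Sym2.map f))).card = k ! ∧
    ∀ τ ∈ pairings Finset.univ, Connected (2 * k) W (D + τ.val.map (Sym2.map f)) →
      Decomposes k W (D + τ.val.map (Sym2.map f))

theorem minimalStar_of_equiv {E' : Type*} [Fintype E'] [DecidableEq E'] (e : E ≃ E') {k : ℕ}
    {W : Finset V} {D : Multiset (Sym2 V)} {f : E → V} {f' : E' → V} (hf : ∀ x, f' (e x) = f x) :
    MinimalStar k W D f ↔ MinimalStar k W D f' := by
  classical
  have hm : ∀ τ : Finset (Sym2 E),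
      (τ.image (Sym2.map e)).val.map (Sym2.map f') = τ.val.map (Sym2.map f) := by
    intro τ
    rw [Finset.image_val_of_injOn (Sym2.map.injective e.injective).injOn, Multiset.map_map]
    refine Multiset.map_congr rfl fun p _ => ?_
    rw [Function.comp_apply, Sym2.map_map]
    exact Sym2.map_congr fun a _ => hf a
  rw [MinimalStar, MinimalStar,
    card_filter_pairings_congr e _ (fun τ => Connected (2 * k) W (D + τ.val.map (Sym2.map f')))
      fun τ => by rw [hm]]
  refine and_congr_right fun _ => ⟨fun h τ hτ => ?_, fun h τ hτ => ?_⟩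
  · obtain ⟨τ', hτ', rfl⟩ := exists_image_eq_of_mem_pairings e hτ
    rw [hm]
    exact h τ' hτ'
  · rw [← hm]
    exact h _ (image_mem_pairings e hτ)

theorem StarAt.eq_filter {G : Multigraph V} {v : V} {D : Multiset (Sym2 V)} {f : E → V}
    (h : StarAt G v D f) : D = G.edges.filter fun e => v ∉ e := by
  rw [h.edges_eq, Multiset.filter_add, Multiset.filter_eq_self.2, Multiset.filter_eq_nil.2,
    add_zero]
  · intro p hp
    obtain ⟨e, -, rfl⟩ := Multiset.mem_map.1 hp
    simp
  · intro p
    induction p using Sym2.ind with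
    | _ a b =>
      intro hp hv
      have hab := h.within a b hp
      rcases Sym2.mem_iff.1 hv with rfl | rfl
      · simpa using hab.1
      · simpa using hab.2

theorem StarAt.minimalStar_iff {E' : Type*} [Fintype E'] [DecidableEq E'] {k : ℕ}
    {G : Multigraph V} {v : V} {D D' : Multiset (Sym2 V)} {f : E → V} {f' : E' → V}
    (h : StarAt G v D f) (h' : StarAt G v D' f') :
    MinimalStar k (G.verts.erase v) D f ↔ MinimalStar k (G.verts.erase v) D' f' := by
  have hD : D = D' := h.eq_filter.trans h'.eq_filter.symm
  subst hD
  have h1 := add_left_cancel (h.edges_eq.symm.trans h'.edges_eq)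
  have hinj : Function.Injective fun w : V => s(v, w) := fun a b hab => Sym2.congr_right.1 hab
  have h2 : (Finset.univ : Finset E).val.map f = (Finset.univ : Finset E').val.map f' := by
    refine Multiset.map_injective hinj ?_
    rw [Multiset.map_map, Multiset.map_map]
    exact h1
  obtain ⟨e, he⟩ := exists_equiv_of_map_univ_eq f f' h2
  exact minimalStar_of_equiv e he

theorem StarAt.within_pairing {G : Multigraph V} {v : V} {D : Multiset (Sym2 V)} {f : E → V}
    (h : StarAt G v D f) (τ : Finset (Sym2 E)) :
    Within (G.verts.erase v) (D + τ.val.map (Sym2.map f)) := by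
  intro a b hab
  rcases Multiset.mem_add.1 hab with hab | hab
  · exact h.within a b hab
  · obtain ⟨p, -, hp⟩ := Multiset.mem_map.1 hab
    have hm : ∀ c ∈ s(a, b), c ∈ G.verts.erase v := by
      rw [← hp]
      intro c hc
      obtain ⟨e, -, rfl⟩ := Sym2.mem_map.1 hc
      exact h.ends_mem e
    exact ⟨hm a (Sym2.mem_mk_left _ _), hm b (Sym2.mem_mk_right _ _)⟩

/-- The graph with vertices `W` and edges `D`. -/
def ofWithin (W : Finset V) (D : Multiset (Sym2 V)) (h : Within W D) : Multigraph V where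
  verts := W
  edges := D
  incl := by
    intro e
    induction e using Sym2.ind with
    | _ a b =>
      intro he c hc
      rcases Sym2.mem_iff.1 hc with rfl | rfl
      · exact (h _ _ he).1
      · exact (h _ _ he).2

theorem StarAt.not_subset_of_cut_le {G : Multigraph V} {v : V} {D : Multiset (Sym2 V)} {f : E → V}
    (h : StarAt G v D f) {τ : Finset (Sym2 E)} (hτ : τ ∈ pairings Finset.univ) {Y : Finset V}
    (hv : v ∉ Y) (hle : cut G.edges Y ≤ cut (D + τ.val.map (Sym2.map f)) Y) :
    ∀ p ∈ τ, ¬ (Sym2.map f p).toFinset ⊆ Y := by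
  have h1 := h.cut_pairing_add hτ hv
  have h2 : (τ.filter fun p => (Sym2.map f p).toFinset ⊆ Y).card = 0 := by omega
  rw [Finset.card_eq_zero, Finset.filter_eq_empty_iff] at h2
  exact fun p hp => h2 hp

/-- A `2 * k`-edge cut with sides `X` and `Y`. -/
structure IsTightCut (k : ℕ) (G : Multigraph V) (X Y : Finset V) : Prop where
  disjoint : Disjoint X Y
  union_eq : X ∪ Y = G.verts
  two_le_left : 2 ≤ X.card
  two_le_right : 2 ≤ Y.card
  cutSize_eq : G.cutSize X = 2 * k

theorem IsTightCut.sdiff_left {k : ℕ} {G : Multigraph V} {X Y : Finset V}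
    (h : IsTightCut k G X Y) : G.verts \ X = Y := by
  rw [← h.union_eq, Finset.union_sdiff_cancel_left h.disjoint]

theorem IsTightCut.symm {k : ℕ} {G : Multigraph V} {X Y : Finset V} (h : IsTightCut k G X Y) :
    IsTightCut k G Y X where
  disjoint := h.disjoint.symm
  union_eq := by rw [Finset.union_comm, h.union_eq]
  two_le_left := h.two_le_right
  two_le_right := h.two_le_left
  cutSize_eq := by
    rw [← h.cutSize_eq, cutSize_eq_cut, cutSize_eq_cut, ← h.sdiff_left, cut_compl (within_edges G)]

theorem IsTightCut.card_add {k : ℕ} {G : Multigraph V} {X Y : Finset V}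
    (h : IsTightCut k G X Y) : X.card + Y.card = G.verts.card := by
  rw [← h.union_eq, Finset.card_union_of_disjoint h.disjoint]

theorem IsTightCut.right_subset {k : ℕ} {G : Multigraph V} {X Y : Finset V}
    (h : IsTightCut k G X Y) : Y ⊆ G.verts := by
  rw [← h.union_eq]
  exact Finset.subset_union_right

theorem IsTightCut.erase_sdiff_right {k : ℕ} {G : Multigraph V} {X Y : Finset V}
    (h : IsTightCut k G X Y) (v : V) : G.verts.erase v \ Y = X.erase v := by
  rw [Finset.erase_sdiff_comm, h.symm.sdiff_left]

/-- A transition preserves connectivity if and only if it does so after collapsing the side of a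
tight cut that does not contain `v`. -/
theorem StarAt.connected_iff_collapse {k : ℕ} {G : Multigraph V} {v : V} {D : Multiset (Sym2 V)}
    {f : E → V} (h : StarAt G v D f) (hconn : G.EdgeConnected (2 * k)) {X Y : Finset V} {y : V}
    (hXY : IsTightCut k G X Y) (hv : v ∈ X) (hy : y ∈ Y) {τ : Finset (Sym2 E)}
    (hτ : τ ∈ pairings Finset.univ) :
    Connected (2 * k) (G.verts.erase v) (D + τ.val.map (Sym2.map f)) ↔
      Connected (2 * k) (insert y (X.erase v))
        (collapseEdges D Y y + τ.val.map (Sym2.map fun e => retract Y y (f e))) := by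
  have hvY : v ∉ Y := Finset.disjoint_left.1 hXY.disjoint hv
  have hYW : Y ⊆ G.verts.erase v := fun a ha =>
    Finset.mem_erase.2 ⟨by rintro rfl; exact hvY ha, hXY.right_subset ha⟩
  have hsd := hXY.erase_sdiff_right v
  have hcut : ∀ Z Z' : Finset V, (∀ a, a ∈ Z' ↔ retract Y y a ∈ Z) →
      cut (collapseEdges D Y y + τ.val.map (Sym2.map fun e => retract Y y (f e))) Z =
        cut (D + τ.val.map (Sym2.map f)) Z' := by
    intro Z Z' hZ
    rw [cut_add, cut_add, cut_collapseEdges hZ, cut_map_pairing_retract hZ]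
  constructor
  · intro hc
    rw [← hsd]
    exact connected_collapse hYW hy hc hcut
  · intro hc
    have hW := h.within_pairing τ
    have hyX : y ∉ X.erase v := fun h' =>
      Finset.disjoint_left.1 hXY.disjoint (Finset.mem_of_mem_erase h') hy
    have hXne : (X.erase v).Nonempty := by
      rw [← Finset.card_pos, Finset.card_erase_of_mem hv]
      have := hXY.two_le_left
      omega
    have hGY : cut G.edges Y = 2 * k := hXY.symm.cutSize_eq
    have hHY : 2 * k ≤ cut (D + τ.val.map (Sym2.map f)) Y := by
      rw [← hcut {y} Y fun a => ?_]
      · refine hc {y} (by simp) ⟨y, by simp⟩ ?_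
        obtain ⟨u, hu⟩ := hXne
        exact ⟨u, Finset.mem_sdiff.2 ⟨Finset.mem_insert_of_mem hu, by
          rw [Finset.mem_singleton]; rintro rfl; exact hyX hu⟩⟩
      · rw [← mem_union_iff_retract_mem (Finset.mem_singleton_self y), Finset.mem_union,
          Finset.mem_singleton]
        exact ⟨.inr, by rintro (rfl | h) <;> assumption⟩
    have hNP := h.not_subset_of_cut_le hτ hvY (by omega)
    have hinY : ∀ Z ⊆ Y, Z.Nonempty → 2 * k ≤ cut (D + τ.val.map (Sym2.map f)) Z := by
      intro Z hZ hne
      have h1 := h.cut_pairing_add hτ (fun h' => hvY (hZ h'))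
      rw [Finset.filter_eq_empty_iff.2 fun p hp hs => hNP p hp (hs.trans hZ)] at h1
      have h2 : 2 * k ≤ cut G.edges Z := hconn Z (hZ.trans hXY.right_subset) hne
        ⟨v, Finset.mem_sdiff.2 ⟨h.mem, fun h' => hvY (hZ h')⟩⟩
      simp only [Finset.card_empty] at h1
      omega
    have hinX : ∀ Z ⊆ X.erase v, Z.Nonempty → 2 * k ≤ cut (D + τ.val.map (Sym2.map f)) Z := by
      intro Z hZ hne
      rw [← hcut Z Z (mem_iff_retract_mem_of_notMem
        (hXY.disjoint.mono_left (hZ.trans (Finset.erase_subset _ _))) fun h' => hyX (hZ h'))]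
      exact hc Z (hZ.trans (Finset.subset_insert _ _)) hne
        ⟨y, Finset.mem_sdiff.2 ⟨Finset.mem_insert_self _ _, fun h' => hyX (hZ h')⟩⟩
    intro Z hZ hne hne'
    by_cases h1 : (Z ∩ Y).Nonempty
    · by_cases h2 : (G.verts.erase v \ (Z ∪ Y)).Nonempty
      · have h3 := hinY _ Finset.inter_subset_right h1
        have h4 := hinX _ (by
          rw [← hsd]
          exact Finset.sdiff_subset_sdiff subset_rfl Finset.subset_union_right) h2
        rw [cut_compl hW] at h4
        have h5 := cut_inter_add_cut_union_le (D + τ.val.map (Sym2.map f)) Z Y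
        have h6 := h.cut_pairing_add hτ hvY
        omega
      · rw [← cut_compl hW]
        refine hinY _ (fun a ha => ?_) hne'
        rw [Finset.mem_sdiff] at ha
        by_contra haY
        exact h2 ⟨a, Finset.mem_sdiff.2 ⟨ha.1, by simp [ha.2, haY]⟩⟩
    · refine hinX Z (fun a ha => ?_) hne
      rw [← hsd]
      exact Finset.mem_sdiff.2 ⟨hZ ha, fun haY => h1 ⟨a, Finset.mem_inter.2 ⟨ha, haY⟩⟩⟩

theorem collapse_singleton_self {G : Multigraph V} (hG : ¬ G.HasLoop) {w : V} (hw : w ∈ G.verts) :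
    G.collapse {w} w = G := by
  refine ext_of_eq ?_ ?_
  · rw [collapse_verts, Finset.insert_sdiff_self_of_mem hw]
  · have hr : retract {w} w = id := by
      funext a
      simp [retract, eq_comm]
    rw [collapse_edges, collapseEdges, hr, Sym2.map_id, Multiset.map_id,
      Multiset.filter_eq_self]
    intro e
    induction e using Sym2.ind with
    | _ a b =>
      intro he hs
      rw [toFinset_mk_subset_iff, Finset.mem_singleton, Finset.mem_singleton] at hs
      rw [hs.1, hs.2] at he
      exact hG ⟨w, hw, he⟩

theorem StarAt.decomposes_iff_collapse {k : ℕ} {G : Multigraph V} {v : V} {D : Multiset (Sym2 V)}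
    {f : E → V} (h : StarAt G v D f) (hreg : G.IsRegular (2 * k))
    {X Y : Finset V} {x y : V}
    (hXY : IsTightCut k G X Y) (hv : v ∈ X) (hx : x ∈ X) (hy : y ∈ Y) {τ : Finset (Sym2 E)}
    (hτ : τ ∈ pairings Finset.univ)
    (hc : Connected (2 * k) (G.verts.erase v) (D + τ.val.map (Sym2.map f)))
    (hU : ∀ H : Multigraph V, H.verts = G.verts.erase v → H.IsRegular (2 * k) →
      H.EdgeConnected (2 * k) → IsTightCut k H (X.erase v) Y → ∀ x' ∈ X.erase v,
      (H.TotallyDecomposable k ↔ (H.collapse Y y).TotallyDecomposable k ∧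
        (H.collapse (X.erase v) x').TotallyDecomposable k)) :
    Decomposes k (G.verts.erase v) (D + τ.val.map (Sym2.map f)) ↔
      Decomposes k (insert y (X.erase v))
        (collapseEdges D Y y + τ.val.map (Sym2.map fun e => retract Y y (f e))) ∧
      (G.collapse X x).TotallyDecomposable k := by
  have hvY : v ∉ Y := Finset.disjoint_left.1 hXY.disjoint hv
  have hYW : Y ⊆ G.verts.erase v := fun a ha =>
    Finset.mem_erase.2 ⟨by rintro rfl; exact hvY ha, hXY.right_subset ha⟩
  have hyX : y ∉ X.erase v := fun h' =>
    Finset.disjoint_left.1 hXY.disjoint (Finset.mem_of_mem_erase h') hy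
  have hsd := hXY.erase_sdiff_right v
  have hX2 := hXY.two_le_left
  have hY2 := hXY.two_le_right
  have hXc := Finset.card_erase_add_one hv
  have hXW : X.erase v ⊆ G.verts.erase v := by rw [← hsd]; exact Finset.sdiff_subset
  have hsd' : G.verts.erase v \ X.erase v = Y := by
    rw [← hsd, Finset.sdiff_sdiff_eq_self hYW]
  have hun : X.erase v ∪ Y = G.verts.erase v := by
    rw [← hsd, Finset.sdiff_union_of_subset hYW]
  have hdis : Disjoint (X.erase v) Y := hXY.disjoint.mono_left (Finset.erase_subset _ _)
  have hWc : (X.erase v).card + Y.card = (G.verts.erase v).card := by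
    rw [← hun, Finset.card_union_of_disjoint hdis]
  have hXne : (X.erase v).Nonempty := Finset.card_pos.1 (by omega)
  have hW := h.within_pairing τ
  set H := ofWithin _ _ hW with hH
  have hHreg : H.IsRegular (2 * k) := fun u hu => by
    rw [degree_eq_deg]
    exact (h.deg_pairing hτ (Finset.ne_of_mem_erase hu)).trans
      (hreg u (Finset.mem_of_mem_erase hu))
  have hHc : H.EdgeConnected (2 * k) := hc
  have hGY : cut G.edges Y = 2 * k := hXY.symm.cutSize_eq
  have hHY := hc Y hYW ⟨y, hy⟩ (by rwa [hsd])
  have hNP := h.not_subset_of_cut_le hτ hvY (by omega)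
  have hHX : H.cutSize (X.erase v) = 2 * k := by
    have h1 := h.cut_pairing_add hτ hvY
    have h2 : cut (D + τ.val.map (Sym2.map f)) (X.erase v) =
        cut (D + τ.val.map (Sym2.map f)) Y := by
      rw [← hsd', cut_compl hW]
    rw [cutSize_eq_cut]
    change cut (D + τ.val.map (Sym2.map f)) (X.erase v) = 2 * k
    omega
  have hcX : ∀ x', H.collapse (X.erase v) x' = G.collapse X x' := by
    intro x'
    refine ext_of_eq ?_ ?_
    · rw [collapse_verts, collapse_verts]
      change insert x' (G.verts.erase v \ X.erase v) = _
      rw [hsd', hXY.sdiff_left]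
    · refine h.collapseEdges_erase hv hτ fun a b hab => ?_
      by_contra hcon
      rw [not_or] at hcon
      refine hNP _ hab ?_
      rw [Sym2.map_mk, toFinset_mk_subset_iff, ← hXY.sdiff_left]
      exact ⟨Finset.mem_sdiff.2 ⟨Finset.mem_of_mem_erase (h.ends_mem a), hcon.1⟩,
        Finset.mem_sdiff.2 ⟨Finset.mem_of_mem_erase (h.ends_mem b), hcon.2⟩⟩
  have hcYv : (H.collapse Y y).verts = insert y (X.erase v) := by
    rw [collapse_verts]
    change insert y (G.verts.erase v \ Y) = _
    rw [hsd]
  have hcYe : (H.collapse Y y).edges =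
      collapseEdges D Y y + τ.val.map (Sym2.map fun e => retract Y y (f e)) := by
    rw [collapse_edges]
    change collapseEdges (D + τ.val.map (Sym2.map f)) Y y = _
    rw [collapseEdges_add, collapseEdges_pairing hNP]
  have hd : Decomposes k (G.verts.erase v) (D + τ.val.map (Sym2.map f)) ↔
      H.TotallyDecomposable k := decomposes_iff (H := H) (by
    change 3 ≤ (G.verts.erase v).card
    omega)
  rw [hd, ← hcYv, ← hcYe]
  by_cases h2 : 2 ≤ (X.erase v).card
  · obtain ⟨x', hx'⟩ := hXne
    rw [hU H rfl hHreg hHc ⟨hdis, hun, h2, hY2, hHX⟩ x' hx', hcX,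
      totallyDecomposable_collapse_congr G (Finset.mem_of_mem_erase hx') hx, decomposes_iff]
    rw [hcYv, Finset.card_insert_of_notMem hyX]
    omega
  · obtain ⟨w, hw⟩ := Finset.card_eq_one.1 (by omega : (X.erase v).card = 1)
    have hwX : w ∈ X.erase v := by simp [hw]
    have h3 : Decomposes k (H.collapse Y y).verts (H.collapse Y y).edges := by
      refine .inl ?_
      rw [hcYv, Finset.card_insert_of_notMem hyX]
      omega
    have hHG : H = G.collapse X w := by
      rw [← hcX, hw, collapse_singleton_self _ (hXW hwX)]
      refine not_hasLoop_of_connected hHreg hHc ?_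
      change 2 ≤ (G.verts.erase v).card
      omega
    rw [and_iff_right h3, totallyDecomposable_collapse_congr G hx (Finset.mem_of_mem_erase hwX),
      ← hHG]

theorem StarAt.minimalStar_iff_collapse {k : ℕ} {G : Multigraph V} {v : V} {D : Multiset (Sym2 V)}
    {f : E → V} (h : StarAt G v D f) (hreg : G.IsRegular (2 * k))
    (hconn : G.EdgeConnected (2 * k)) {X Y : Finset V} {x y : V}
    (hXY : IsTightCut k G X Y) (hv : v ∈ X) (hx : x ∈ X) (hy : y ∈ Y)
    (hU : ∀ H : Multigraph V, H.verts = G.verts.erase v → H.IsRegular (2 * k) →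
      H.EdgeConnected (2 * k) → IsTightCut k H (X.erase v) Y → ∀ x' ∈ X.erase v,
      (H.TotallyDecomposable k ↔ (H.collapse Y y).TotallyDecomposable k ∧
        (H.collapse (X.erase v) x').TotallyDecomposable k)) :
    MinimalStar k (G.verts.erase v) D f ↔
      MinimalStar k (insert y (X.erase v)) (collapseEdges D Y y) (fun e => retract Y y (f e)) ∧
      (G.collapse X x).TotallyDecomposable k := by
  classical
  have hcc := fun τ hτ => h.connected_iff_collapse hconn hXY hv hy (τ := τ) hτ
  have hdd := fun τ hτ hc => h.decomposes_iff_collapse hreg hXY hv hx hy (τ := τ) hτ hc hU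
  rw [MinimalStar, MinimalStar, Finset.filter_congr hcc]
  constructor
  · rintro ⟨h1, h2⟩
    refine ⟨⟨h1, fun τ hτ hc => ?_⟩, ?_⟩
    · have hc' := (hcc τ hτ).2 hc
      exact ((hdd τ hτ hc').1 (h2 τ hτ hc')).1
    · obtain ⟨τ, hτ⟩ := Finset.card_pos.1 (h1 ▸ k.factorial_pos)
      rw [Finset.mem_filter] at hτ
      have hc' := (hcc τ hτ.1).2 hτ.2
      exact ((hdd τ hτ.1 hc').1 (h2 τ hτ.1 hc')).2
  · rintro ⟨⟨h1, h2⟩, h3⟩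
    refine ⟨h1, fun τ hτ hc => ?_⟩
    exact (hdd τ hτ hc).2 ⟨h2 τ hτ ((hcc τ hτ).1 hc), h3⟩

/-- In a graph with three vertices, exactly `k!` transitions preserve connectivity. -/
theorem StarAt.minimalStar_of_card_eq_three {k : ℕ} {G : Multigraph V} {v : V}
    {D : Multiset (Sym2 V)} {f : E → V} (h : StarAt G v D f) (hreg : G.IsRegular (2 * k))
    (hconn : G.EdgeConnected (2 * k)) (hn : G.verts.card = 3) :
    MinimalStar k (G.verts.erase v) D f := by
  classical
  have hG := not_hasLoop_of_connected hreg hconn (by omega)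
  have hW : (G.verts.erase v).card = 2 := by rw [Finset.card_erase_of_mem h.mem, hn]
  refine ⟨le_antisymm ?_ (h.factorial_le hreg hconn _ fun τ _ h' => h'), fun _ _ _ => .inl hW⟩
  obtain ⟨w, y, hwy, hWe⟩ := Finset.card_eq_two.1 hW
  have hw : w ∈ G.verts.erase v := by simp [hWe]
  have hy : y ∈ G.verts.erase v := by simp [hWe]
  have hsd : G.verts.erase v \ {w} = {y} := by
    rw [hWe]
    ext a
    simp only [Finset.mem_sdiff, Finset.mem_insert, Finset.mem_singleton]
    constructor
    · tauto
    · rintro rfl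
      exact ⟨.inr rfl, hwy.symm⟩
  have hvw : v ∉ ({w} : Finset V) := by simpa using (Finset.ne_of_mem_erase hw).symm
  have hvy : v ∉ ({y} : Finset V) := by simpa using (Finset.ne_of_mem_erase hy).symm
  have h1 := h.cut_eq hvw
  have h2 := h.cut_eq hvy
  rw [cut_singleton_of_not_hasLoop hreg hG (Finset.mem_of_mem_erase hw), starCut] at h1
  rw [cut_singleton_of_not_hasLoop hreg hG (Finset.mem_of_mem_erase hy), starCut] at h2
  have h3 : cut D {y} = cut D {w} := by rw [← hsd, cut_compl h.within]
  have h4 := endsIn_compl (W := G.verts.erase v) (S := Finset.univ) (f := f)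
    (fun e _ => h.ends_mem e) {w}
  rw [hsd, Finset.card_univ, h.card_eq hreg] at h4
  have h5 : (Finset.univ.filter fun e => f e = w).card = endsIn Finset.univ f {w} := by
    rw [Finset.card_filter, endsIn]
    simp
  have h6 := Finset.card_filter_add_card_filter_not (s := Finset.univ) (fun e => f e = w)
  rw [Finset.card_univ, h.card_eq hreg] at h6
  refine card_filter_pairings_le_factorial (fun e => f e = w) k Finset.univ (by omega) (by omega) _
    fun τ hτ hc a b hab ha hb => ?_
  refine h.not_subset_of_cut_le hτ hvw ?_ _ hab ?_
  · rw [cut_singleton_of_not_hasLoop hreg hG (Finset.mem_of_mem_erase hw)]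
    exact hc {w} (by simpa using hw) ⟨w, by simp⟩ (by rw [hsd]; simp)
  · rw [Sym2.map_mk, toFinset_mk_subset_iff]
    simp [ha, hb]

end MinimalStar

end Multigraph

namespace Multigraph

section Main

variable {V : Type*} [DecidableEq V]

theorem exists_pick_eq {G : Multigraph V} {v : V} (hv : v ∈ G.verts) :
    ∃ pick : VertexChoice V, ∀ hne, (pick G hne).1 = v := by
  classical
  refine ⟨fun H hne => if h : H = G then ⟨v, h ▸ hv⟩ else ⟨hne.choose, hne.choose_spec⟩,
    fun hne => ?_⟩
  simp

theorem totallyDecomposable_of_card_eq_three {k : ℕ} {G : Multigraph V}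
    (hconn : G.EdgeConnected (2 * k)) (hn : G.verts.card = 3) : G.TotallyDecomposable k := by
  refine ⟨[G], .single G hn.ge ⟨hconn, fun X hX hne hne' _ => ?_⟩, by simpa using hn⟩
  have h1 := Finset.card_sdiff_add_card_eq_card hX
  have h2 := hne.card_pos
  have h3 := hne'.card_pos
  omega

theorem totallyDecomposable_of_tightCut {k : ℕ} {G : Multigraph V} {X Y : Finset V} {x y : V}
    (hXY : IsTightCut k G X Y) (hx : x ∈ X) (hy : y ∈ Y)
    (hGY : (G.collapse Y y).TotallyDecomposable k) (hGX : (G.collapse X x).TotallyDecomposable k) :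
    G.TotallyDecomposable k := by
  obtain ⟨L₁, h1, h1'⟩ := hGY
  obtain ⟨L₂, h2, h2'⟩ := hGX
  refine ⟨L₁ ++ L₂, .cut G X Y hXY.disjoint hXY.union_eq hXY.two_le_left hXY.two_le_right
    hXY.cutSize_eq x y hx hy L₁ L₂ h1 h2, fun H hH => ?_⟩
  rcases List.mem_append.1 hH with h | h
  · exact h1' H h
  · exact h2' H h

theorem TotallyDecomposable.exists_tightCut {k : ℕ} {G : Multigraph V}
    (h : G.TotallyDecomposable k) (hn : 4 ≤ G.verts.card) :
    ∃ X Y, IsTightCut k G X Y ∧ ∃ x ∈ X, ∃ y ∈ Y,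
      (G.collapse Y y).TotallyDecomposable k ∧ (G.collapse X x).TotallyDecomposable k := by
  obtain ⟨L, hL, hL3⟩ := h
  cases hL with
  | single _ _ _ => have := hL3 G (by simp); omega
  | cut _ X Y hXY hun hX hY hcut x y hx hy L₁ L₂ h₁ h₂ =>
    exact ⟨X, Y, ⟨hXY, hun, hX, hY, hcut⟩, x, hx, y, hy,
      ⟨L₁, h₁, fun H hH => hL3 H (List.mem_append_left _ hH)⟩,
      ⟨L₂, h₂, fun H hH => hL3 H (List.mem_append_right _ hH)⟩⟩

theorem exists_tightCut_of_not_cyclicallyConnected {k : ℕ} {G : Multigraph V}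
    (hconn : G.EdgeConnected (2 * k)) (h : ¬ G.CyclicallyConnected k) :
    ∃ X Y, IsTightCut k G X Y := by
  simp only [CyclicallyConnected, hconn, true_and, not_forall, not_or] at h
  obtain ⟨X, hX, hne, hne', hcut, h1, h2⟩ := h
  have h3 := hne.card_pos
  have h4 := hne'.card_pos
  exact ⟨X, G.verts \ X, Finset.disjoint_sdiff, Finset.union_sdiff_of_subset hX, by omega,
    by omega, hcut⟩

/-- The Martin invariant is minimal if and only if the transitions at the picked vertex are
minimal. -/
theorem StarAt.martin_eq_iff {E : Type*} [Fintype E] [DecidableEq E] {k : ℕ} {G : Multigraph V}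
    {v : V} {D : Multiset (Sym2 V)} {f : E → V} (h : StarAt G v D f)
    (hreg : G.IsRegular (2 * k)) (hconn : G.EdgeConnected (2 * k)) (hn : 4 ≤ G.verts.card)
    (pick : VertexChoice V) (hpick : ∀ hne, (pick G hne).1 = v)
    (ih : ∀ H : Multigraph V, H.verts.card + 1 = G.verts.card → H.IsRegular (2 * k) →
      H.EdgeConnected (2 * k) →
      (H.martin k pick = (k ! : ℚ) ^ ((H.verts.card : ℤ) - 3) ↔ H.TotallyDecomposable k)) :
    G.martin k pick = (k ! : ℚ) ^ ((G.verts.card : ℤ) - 3) ↔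
      MinimalStar k (G.verts.erase v) D f := by
  classical
  have hG := not_hasLoop_of_connected hreg hconn (by omega)
  have hne : G.verts.Nonempty := ⟨v, h.mem⟩
  obtain ⟨n, hn'⟩ := Nat.exists_eq_add_of_le' (by omega : 1 ≤ G.verts.card)
  have hstar := starAt_of_not_hasLoop hG h.mem
  have hcard : (G.verts.erase v).card = n := by
    rw [Finset.card_erase_of_mem h.mem, hn', Nat.add_sub_cancel]
  rw [hn', Multigraph.martin_eq_iff pick hreg hconn hG hn' (by omega) hne, hpick hne,
    h.minimalStar_iff hstar, MinimalStar, goodTransitions, transitions_eq_pairings]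
  refine and_congr Iff.rfl ?_
  simp only [Finset.mem_filter, and_imp]
  refine forall₂_congr fun τ hτ => forall_congr' fun hc => ?_
  have h1 := ih (G.applyTransition hG v τ) (by rw [applyTransition_verts, hcard, hn'])
    (isRegular_applyTransition hreg hG h.mem (by rwa [transitions_eq_pairings])) hc
  rw [applyTransition_verts, hcard] at h1
  rw [h1]
  exact (decomposes_iff (H := G.applyTransition hG v τ)
    (by rw [applyTransition_verts, hcard]; omega)).symm

theorem card_collapse {G : Multigraph V} {k : ℕ} {X Y : Finset V} (h : IsTightCut k G X Y) {y : V}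
    (hy : y ∈ Y) : (G.collapse Y y).verts.card = X.card + 1 := by
  rw [collapse_verts, h.symm.sdiff_left,
    Finset.card_insert_of_notMem fun h' => Finset.disjoint_left.1 h.disjoint h' hy]

/-- The Martin invariant is minimal if and only if the graph is totally decomposable, which can be
tested along any tight cut. -/
theorem martin_eq_iff_totallyDecomposable (k n : ℕ) :
    ∀ G : Multigraph V, G.verts.card = n → 3 ≤ n → G.IsRegular (2 * k) →
      G.EdgeConnected (2 * k) →
      (∀ pick : VertexChoice V, G.martin k pick = (k ! : ℚ) ^ ((G.verts.card : ℤ) - 3) ↔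
        G.TotallyDecomposable k) ∧
      ∀ X Y, IsTightCut k G X Y → ∀ x ∈ X, ∀ y ∈ Y, (G.TotallyDecomposable k ↔
        (G.collapse Y y).TotallyDecomposable k ∧ (G.collapse X x).TotallyDecomposable k) := by
  induction n using Nat.strong_induction_on with
  | _ n ih =>
    intro G hn h3 hreg hconn
    have hG := not_hasLoop_of_connected hreg hconn (by omega)
    by_cases hn3 : n = 3
    · constructor
      · intro pick
        rw [martin_of_card_eq_three k pick hG (by omega), hn, hn3]
        simpa using totallyDecomposable_of_card_eq_three hconn (hn.trans hn3)
      · intro X Y hXY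
        have := hXY.card_add
        have := hXY.two_le_left
        have := hXY.two_le_right
        omega
    have hM : ∀ {H : Multigraph V} {v : V} {E : Type _} [Fintype E] [DecidableEq E]
        {D : Multiset (Sym2 V)} {f : E → V}, StarAt H v D f → H.IsRegular (2 * k) →
        H.EdgeConnected (2 * k) → 4 ≤ H.verts.card → H.verts.card ≤ n →
        ∀ pick : VertexChoice V, (∀ hne, (pick H hne).1 = v) →
        (H.martin k pick = (k ! : ℚ) ^ ((H.verts.card : ℤ) - 3) ↔
          MinimalStar k (H.verts.erase v) D f) := by
      intro H v E _ _ D f hS hr hc h4 hle pick hp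
      exact hS.martin_eq_iff hr hc h4 pick hp fun H' hH' hr' hc' =>
        (ih _ (by omega) H' rfl (by omega) hr' hc').1 pick
    have key : ∀ X Y, IsTightCut k G X Y → ∀ v ∈ X, ∀ x ∈ X, ∀ y ∈ Y,
        (MinimalStar k (G.verts.erase v) (G.edges.filter fun e => v ∉ e)
          (fun x : G.EdgeAt v => (x.1 : V)) ↔
        (G.collapse Y y).TotallyDecomposable k ∧ (G.collapse X x).TotallyDecomposable k) := by
      intro X Y hXY v hv x hx y hy
      have hXc := hXY.card_add
      have hX2 := hXY.two_le_left
      have hY2 := hXY.two_le_right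
      have hvG : v ∈ G.verts := by rw [← hXY.union_eq]; exact Finset.mem_union_left _ hv
      have hvY : v ∉ Y := Finset.disjoint_left.1 hXY.disjoint hv
      have hstar := starAt_of_not_hasLoop hG hvG
      have hstar1 := hstar.collapse (Y := Y) (y := y) hvY hy
      have hreg1 := isRegular_collapse hy hreg hXY.symm.cutSize_eq
      have hconn1 := edgeConnected_collapse hXY.right_subset hy hconn
      have hc1 := card_collapse hXY hy
      have hv1 : (G.collapse Y y).verts.erase v = insert y (X.erase v) := by
        rw [collapse_verts, hXY.symm.sdiff_left,
          Finset.erase_insert_of_ne (by rintro rfl; exact hvY hy)]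
      rw [hstar.minimalStar_iff_collapse hreg hconn hXY hv hx hy, ← hv1]
      · refine and_congr_left fun _ => ?_
        by_cases h2 : X.card = 2
        · exact iff_of_true (hstar1.minimalStar_of_card_eq_three hreg1 hconn1 (by omega))
            (totallyDecomposable_of_card_eq_three hconn1 (by omega))
        · obtain ⟨pick, hpick⟩ := exists_pick_eq hstar1.mem
          rw [← hM hstar1 hreg1 hconn1 (by omega) (by omega) pick hpick]
          exact (ih _ (by omega) _ rfl (by omega) hreg1 hconn1).1 pick
      · intro H hH hHr hHc hHcut x' hx'
        have hHn : H.verts.card + 1 = n := by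
          rw [hH, Finset.card_erase_add_one hvG, hn]
        exact (ih _ (by omega) H rfl (by omega) hHr hHc).2 _ _ hHcut x' hx' y hy
    have hS : ∀ pick : VertexChoice V, G.martin k pick = (k ! : ℚ) ^ ((G.verts.card : ℤ) - 3) ↔
        G.TotallyDecomposable k := by
      intro pick
      have hne : G.verts.Nonempty := Finset.card_pos.1 (by omega)
      have hvG := (pick G hne).2
      have hm := hM (starAt_of_not_hasLoop hG hvG) hreg hconn (by omega) hn.le pick fun _ => rfl
      constructor
      · intro h
        obtain ⟨X, Y, hXY⟩ := exists_tightCut_of_not_cyclicallyConnected hconn fun hcyc =>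
          (lt_martin pick hreg hcyc (by omega)).ne' h
        rw [hm] at h
        obtain ⟨x, hx⟩ := Finset.card_pos.1 (lt_of_lt_of_le two_pos hXY.two_le_left)
        obtain ⟨y, hy⟩ := Finset.card_pos.1 (lt_of_lt_of_le two_pos hXY.two_le_right)
        rcases Finset.mem_union.1 ((Finset.ext_iff.1 hXY.union_eq _).2 hvG) with hv | hv
        · obtain ⟨h1, h2⟩ := (key X Y hXY _ hv x hx y hy).1 h
          exact totallyDecomposable_of_tightCut hXY hx hy h1 h2
        · obtain ⟨h1, h2⟩ := (key Y X hXY.symm _ hv y hy x hx).1 h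
          exact totallyDecomposable_of_tightCut hXY hx hy h2 h1
      · intro h
        rw [hm]
        obtain ⟨X, Y, hXY, x, hx, y, hy, h1, h2⟩ := h.exists_tightCut (by omega)
        rcases Finset.mem_union.1 ((Finset.ext_iff.1 hXY.union_eq _).2 hvG) with hv | hv
        · exact (key X Y hXY _ hv x hx y hy).2 ⟨h1, h2⟩
        · exact (key Y X hXY.symm _ hv y hy x hx).2 ⟨h2, h1⟩
    refine ⟨hS, fun X Y hXY x hx y hy => ?_⟩
    have hxG : x ∈ G.verts := by rw [← hXY.union_eq]; exact Finset.mem_union_left _ hx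
    obtain ⟨pick, hpick⟩ := exists_pick_eq hxG
    rw [← hS pick, hM (starAt_of_not_hasLoop hG hxG) hreg hconn (by omega) hn.le pick hpick]
    exact key X Y hXY x hx x hx y hy

end Main

end Multigraph

theorem mainTheorem6 {V : Type*} [DecidableEq V] (k : ℕ) (pick : Multigraph.VertexChoice V)
    (G : Multigraph V) (hreg : G.IsRegular (2 * k)) (hconn : G.EdgeConnected (2 * k))
    (hn : 2 ≤ G.verts.card) :
    (k ! : ℚ) ^ ((G.verts.card : ℤ) - 3) ≤ G.martin k pick ∧
    (G.verts.card = 2 → G.martin k pick = (k ! : ℚ) ^ ((G.verts.card : ℤ) - 3)) ∧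
    (3 ≤ G.verts.card →
      (G.martin k pick = (k ! : ℚ) ^ ((G.verts.card : ℤ) - 3) ↔ G.TotallyDecomposable k)) ∧
    (4 ≤ G.verts.card → G.CyclicallyConnected k →
      (k ! : ℚ) ^ ((G.verts.card : ℤ) - 3) < G.martin k pick) :=
  ⟨Multigraph.le_martin k pick _ G rfl hn hreg hconn,
    Multigraph.martin_of_card_eq_two pick (Multigraph.not_hasLoop_of_connected hreg hconn hn),
    fun h3 => (Multigraph.martin_eq_iff_totallyDecomposable k _ G rfl h3 hreg hconn).1 pick,
    fun h4 hcyc => Multigraph.lt_martin pick hreg hcyc h4⟩
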